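/- Let $p\ge 5$ be a prime and let $\mathcal K$ be a field of characteristic $p$ that is complete with respect to a non-Archimedean absolute value $|\cdot|$. Call a power series over $\mathcal K$ locally analytic at $z=0$ if it converges on a disc of positive radius around $0$. A locally analytic power series $f(z)=\lambda z+\sum_{i\ge 1}a_i z^{i+1}$ over $\mathcal K$ is called linearizable if there is a locally analytic power series $h(z)=b_0z+b_1z^2+\cdots\in\mathcal K[[z]]$ with $b_0\ne 0$ such that $h\circ f\circ h^{-1}(z)=\lambda z$, where $h^{-1}$ is the inverse of $h$ under composition. **Theorem 1.5.** Let $\lambda\in\mathcal K$ be not a root of unity and satisfy $|1-\lambda|<1$, and let $a_1,a_{p-1}\in\mathcal K$. Then the polynomial $\lambda z+a_1z^2+a_{p-1}z^p\in\mathcal K[z]$ is linearizable if and only if $a_1=0$. -/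

import Mathlib

namespace NonArchLinearization

variable {K : Type*} [NormedField K]

/-- A power series over a non-Archimedean field is locally analytic at `z = 0` if it converges on
a disc of positive radius, i.e. `‖aₙ‖ rⁿ → 0` for some `r > 0`. -/
def IsLocallyAnalytic (f : PowerSeries K) : Prop :=
  ∃ r : ℝ, 0 < r ∧ PowerSeries.IsRestricted r f

/-- A power series `f` without constant term, with linear coefficient `λ`, is (locally)
linearizable at `z = 0` if there is a locally analytic power series `h(z) = b₀ z + b₁ z² + ⋯`
with `b₀ ≠ 0` such that `h ∘ f ∘ h⁻¹ = λ z`. Here `g.subst a` is the composition `g ∘ a`, and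
`h.substInvOfIsUnit hb` is the inverse of `h` for composition. -/
def IsLinearizable (f : PowerSeries K) : Prop :=
  ∃ (h : PowerSeries K) (hb : IsUnit (PowerSeries.coeff 1 h)),
    IsLocallyAnalytic h ∧ PowerSeries.constantCoeff h = 0 ∧
      h.subst (f.subst (h.substInvOfIsUnit hb)) =
        PowerSeries.C (PowerSeries.coeff 1 f) * PowerSeries.X

end NonArchLinearization

/-! Suppose `f = λz + bz² + azᵖ` is linearizable with `b ≠ 0`. The inverse linearization `ψ`
satisfies `f(ψ(z)) = ψ(λz)` and, suitably normalized, has geometrically bounded coefficients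
(`HasPoincareSeries`). Let `A` be the operator `F ↦ F ∘ f`. Substitution of `ψ` makes `A` diagonal
with eigenvalues `λⁿ`, so `(A - 1)(A - λ)⋯(A - λᴺ⁻¹)` acts by numbers bounded by `∏_{1≤i≤N} |λⁱ -
1|`, because Gaussian binomials are integral. In characteristic `p`, `λ^(pᵏ) - 1 = (λ - 1)^(pᵏ)`,
which makes this product decay superexponentially along `N = pᵏm`. So these operators cannot
produce, in degrees growing linearly with `N`, coefficients with an exponential lower bound: this is
`HasPoincareSeries.not_pow_le`, the source of contradictions.

The first use is integrality of the `q`-binomials of `A` applied to `X`, when `f = X + (λ - 1)g`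
with `g = X + ⋯` integral (`HasPoincareSeries.coeffLE_qBinom`). At a first non-integral order, the
`q`-binomial is nearly a vector field `a∂` with `|a| > 1`. It commutes with `A`, hence nearly with
`g∂`, which forces the leading exponent of `a` to be `1` modulo `p`. Iterates of `a∂` on `X` then
never lose their leading coefficient, contrary to the decay.

Differentiating integral `q`-binomials at a fixed point in the unit disc shows that its multiplier
`μ` lies within `|λᵐ - 1|` of some `λⁱ` with `i < m`, for every `m > 0`
(`exists_norm_multiplier_sub_le`). Since `(azᵖ)' = 0`, the multiplier at `x` is just `λ + 2bx`, and
this is too rigid.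

With `E = λ - 1`, the scaling invariant `β = aEᵖ⁻²/bᵖ⁻¹` separates the cases. If `|β| < 1` and `|β|
≠ |E|`, one fixed point with multiplier close to `λ⁻¹` gives a contradiction. If `|β| = |E|`, `f` is
close to the flow of `(X² + Xᵖ)∂`, whose iterates on `(X² + Xᵖ)^((p-1)/2)` are explicit and never
shrink, contrary to the decay. If `|β| ≥ 1`, the nonzero fixed points satisfy `xᵖ⁻¹ = 1 + ηx` after
scaling, and multipliers at several of them are incompatible.

Conversely, `λz + azᵖ` is an additive polynomial and is linearized by an explicit additive series `∑
cₖ z^(pᵏ)`; its divisors `λ^(pᵏ) - λ` all have norm `|λ - 1|` for `k ≥ 1`, so there are no small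
divisors. -/

namespace NonArchLinearization

open Polynomial Finset

/-! ### q-factorials and q-falling products. -/

section QProducts

variable {L : Type*} [NormedField L]

/-- The product `(λⁿ - 1)(λⁿ⁺¹ - 1) ⋯ (λⁿ⁺ᵏ⁻¹ - 1)`. -/
def qRising (lam : L) (n k : ℕ) : L := ∏ i ∈ range k, (lam ^ (n + i) - 1)

lemma qRising_succ (lam : L) (n k : ℕ) :
    qRising lam n (k + 1) = qRising lam n k * (lam ^ (n + k) - 1) :=
  prod_range_succ _ _

lemma qRising_add (lam : L) (n a b : ℕ) :
    qRising lam n (a + b) = qRising lam n a * qRising lam (n + a) b := by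
  simp only [qRising, prod_range_add, add_assoc]

lemma qRising_succ' (lam : L) (n k : ℕ) :
    qRising lam n (k + 1) = (lam ^ n - 1) * qRising lam (n + 1) k := by
  rw [add_comm k, qRising_add]; simp [qRising]

lemma qRising_one_ne_zero {lam : L} (hroot : ∀ n : ℕ, 0 < n → lam ^ n ≠ 1) (k : ℕ) :
    qRising lam 1 k ≠ 0 :=
  prod_ne_zero_iff.2 fun i _ => sub_ne_zero.2 (hroot _ (by omega))

/-- The product `(x - 1)(x - λ) ⋯ (x - λᵏ⁻¹)`. -/
def qFalling (lam : L) (k : ℕ) (x : L) : L := ∏ i ∈ range k, (x - lam ^ i)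

lemma qFalling_succ (lam : L) (k : ℕ) (x : L) :
    qFalling lam (k + 1) x = qFalling lam k x * (x - lam ^ k) := prod_range_succ _ _

end QProducts

/-! ### Ultrametric estimates and integrality of Gaussian binomials. -/

section Ultrametric

variable {L : Type*} [NormedField L] [IsUltrametricDist L]

lemma norm_add_le_of_le {x y : L} {B : ℝ} (hx : ‖x‖ ≤ B) (hy : ‖y‖ ≤ B) : ‖x + y‖ ≤ B :=
  (IsUltrametricDist.norm_add_le_max x y).trans (max_le hx hy)

lemma norm_sub_le_of_le {x y : L} {B : ℝ} (hx : ‖x‖ ≤ B) (hy : ‖y‖ ≤ B) : ‖x - y‖ ≤ B := by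
  rw [sub_eq_add_neg]
  exact norm_add_le_of_le hx (by rwa [norm_neg])

lemma norm_add_lt_of_lt {x y : L} {B : ℝ} (hx : ‖x‖ < B) (hy : ‖y‖ < B) : ‖x + y‖ < B :=
  (IsUltrametricDist.norm_add_le_max x y).trans_lt (max_lt hx hy)

lemma norm_sub_lt_of_lt {x y : L} {B : ℝ} (hx : ‖x‖ < B) (hy : ‖y‖ < B) : ‖x - y‖ < B := by
  rw [sub_eq_add_neg]
  exact norm_add_lt_of_lt hx (by rwa [norm_neg])

lemma norm_sum_lt_of_lt {ι : Type*} {s : Finset ι} {f : ι → L} {B : ℝ} (hB : 0 < B)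
    (h : ∀ i ∈ s, ‖f i‖ < B) : ‖∑ i ∈ s, f i‖ < B := by
  classical
  induction s using Finset.induction_on with
  | empty => simpa using hB
  | insert a s ha ih =>
    rw [Finset.sum_insert ha]
    exact norm_add_lt_of_lt (h a (by simp)) (ih fun i hi => h i (by simp [hi]))

lemma norm_eq_of_norm_sub_lt {x y : L} (h : ‖x - y‖ < ‖y‖) : ‖x‖ = ‖y‖ := by
  have h1 := IsUltrametricDist.norm_add_eq_max_of_norm_ne_norm h.ne
  rwa [sub_add_cancel, max_eq_right h.le] at h1

lemma norm_eq_one_of_norm_sub_one_lt {x : L} (h : ‖x - 1‖ < 1) : ‖x‖ = 1 := by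
  rw [norm_eq_of_norm_sub_lt (y := 1) (by simpa using h), norm_one]

lemma norm_pow_sub_one_le {x : L} (h : ‖x - 1‖ < 1) (n : ℕ) : ‖x ^ n - 1‖ ≤ ‖x - 1‖ := by
  have hx := norm_eq_one_of_norm_sub_one_lt h
  rw [← mul_geom_sum, norm_mul]
  refine mul_le_of_le_one_right (norm_nonneg _) ?_
  exact IsUltrametricDist.norm_sum_le_of_forall_le_of_nonneg zero_le_one
    fun i _ => by simp [hx]

/-- Integrality of Gaussian binomial coefficients. -/
lemma norm_qRising_le {lam : L} (h : ‖lam‖ = 1) (k : ℕ) :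
    ∀ n, ‖qRising lam n k‖ ≤ ‖qRising lam 1 k‖ := by
  induction k with
  | zero => intro n; simp [qRising]
  | succ k ih =>
    intro n
    induction n with
    | zero =>
      rw [qRising_succ']
      simp
    | succ n ihn =>
      have e : qRising lam (n + 1) (k + 1) = qRising lam n (k + 1)
          + lam ^ n * qRising lam (n + 1) k * (lam ^ (k + 1) - 1) := by
        rw [qRising_succ, qRising_succ' lam n]; ring
      rw [e]
      refine norm_add_le_of_le ihn ?_
      rw [qRising_succ lam 1 k, norm_mul, norm_mul, norm_mul, norm_pow, h, one_pow, one_mul,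
        add_comm 1 k]
      exact mul_le_mul_of_nonneg_right (ih _) (norm_nonneg _)

lemma norm_qRising_one_add_le {lam : L} (h : ‖lam‖ = 1) (a b : ℕ) :
    ‖qRising lam 1 (a + b)‖ ≤ ‖qRising lam 1 a‖ * ‖qRising lam 1 b‖ := by
  rw [qRising_add, norm_mul]
  exact mul_le_mul_of_nonneg_left (norm_qRising_le h _ _) (norm_nonneg _)

/-- For `n < k` a factor vanishes; otherwise, up to powers of the unit `lam`, the quotient of the
two sides is a Gaussian binomial. -/
lemma norm_qFalling_pow_le {lam : L} (h : ‖lam‖ = 1) (k n : ℕ) :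
    ‖qFalling lam k (lam ^ n)‖ ≤ ‖qRising lam 1 k‖ := by
  rcases lt_or_ge n k with hn | hn
  · have : qFalling lam k (lam ^ n) = 0 := prod_eq_zero (mem_range.2 hn) (by simp)
    simp [this]
  · obtain ⟨m, rfl⟩ := Nat.exists_eq_add_of_le hn
    refine le_trans (le_of_eq ?_) (norm_qRising_le h k (m + 1))
    rw [qFalling, qRising, norm_prod, norm_prod, ← prod_range_reflect]
    refine prod_congr rfl fun i hi => ?_
    have hi := mem_range.1 hi
    have : lam ^ (k + m) - lam ^ (k - 1 - i) = lam ^ (k - 1 - i) * (lam ^ (m + 1 + i) - 1) := by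
      rw [mul_sub, ← pow_add, mul_one]; congr 2; omega
    rw [this, norm_mul, norm_pow, h, one_pow, one_mul]

end Ultrametric

/-- The product of powers is `(D ^ p * δ ^ (k + 1)) ^ p ^ k`, whose base tends to zero: the extra
factor `k + 1` beats any exponential. -/
lemma exists_mul_pow_lt_one {δ B D : ℝ} (hδ0 : 0 ≤ δ) (hδ : δ < 1) (hB : 0 ≤ B) (hD : 0 ≤ D)
    {p : ℕ} (hp : 1 < p) : ∃ k : ℕ, B * D ^ p ^ (k + 1) * δ ^ ((k + 1) * p ^ k) < 1 := by
  have h1 : Filter.Tendsto (fun k : ℕ => D ^ p * δ ^ (k + 1)) Filter.atTop (nhds 0) := by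
    have := ((tendsto_pow_atTop_nhds_zero_of_lt_one hδ0 hδ).comp
      (Filter.tendsto_add_atTop_nat 1)).const_mul (D ^ p)
    simpa using this
  have h2 : Filter.Tendsto (fun k : ℕ => B * (1 / 2 : ℝ) ^ p ^ k) Filter.atTop (nhds 0) := by
    have := ((tendsto_pow_atTop_nhds_zero_of_lt_one (by norm_num : (0 : ℝ) ≤ 1 / 2)
      (by norm_num)).comp (tendsto_pow_atTop_atTop_of_one_lt hp)).const_mul B
    simpa using this
  obtain ⟨k, hk1, hk2⟩ := ((h1.eventually_lt_const (by norm_num : (0 : ℝ) < 1 / 2)).and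
    (h2.eventually_lt_const one_pos)).exists
  refine ⟨k, lt_of_le_of_lt ?_ hk2⟩
  rw [mul_assoc]
  refine mul_le_mul_of_nonneg_left ?_ hB
  calc D ^ p ^ (k + 1) * δ ^ ((k + 1) * p ^ k) = (D ^ p * δ ^ (k + 1)) ^ p ^ k := by
        rw [mul_pow, ← pow_mul, ← pow_mul]; congr 2; ring
    _ ≤ _ := pow_le_pow_left₀ (by positivity) hk1.le _

/-! ### Size of q-factorials in characteristic p. -/

section CharP

variable {L : Type*} [NormedField L] {p : ℕ} [hp : Fact p.Prime] [CharP L p]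

/-- Nonzero elements of the prime field are roots of unity. -/
lemma norm_natCast_eq_one {n : ℕ} (hn : ¬ p ∣ n) : ‖(n : L)‖ = 1 := by
  have h1 : (n : ZMod p) ≠ 0 := fun h => hn ((ZMod.natCast_eq_zero_iff _ _).1 h)
  have h2 : (n : L) ^ (p - 1) = 1 := by
    have := congrArg (ZMod.castHom dvd_rfl L) (ZMod.pow_card_sub_one_eq_one h1)
    simpa using this
  have h3 : ‖(n : L)‖ ^ (p - 1) = 1 := by rw [← norm_pow, h2, norm_one]
  exact (pow_eq_one_iff_of_nonneg (norm_nonneg _) (by have := hp.out.two_le; omega)).1 h3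

lemma pow_prime_pow_sub_one (x : L) (k : ℕ) : x ^ p ^ k - 1 = (x - 1) ^ p ^ k := by
  have : ExpChar L p := ExpChar.prime hp.out
  rw [sub_pow_expChar_pow, one_pow]

variable [IsUltrametricDist L]

lemma norm_pow_sub_one_of_not_dvd {x : L} (hx : ‖x - 1‖ < 1) {n : ℕ} (hn : ¬ p ∣ n) :
    ‖x ^ n - 1‖ = ‖x - 1‖ := by
  have h1 : ‖∑ i ∈ range n, x ^ i‖ = 1 := by
    rw [← norm_natCast_eq_one (L := L) hn]
    apply norm_eq_of_norm_sub_lt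
    rw [norm_natCast_eq_one hn]
    have : ∑ i ∈ range n, x ^ i - (n : L) = ∑ i ∈ range n, (x ^ i - 1) := by simp
    rw [this]
    exact norm_sum_lt_of_lt one_pos fun i _ => (norm_pow_sub_one_le hx i).trans_lt hx
  rw [← mul_geom_sum, norm_mul, h1, mul_one]

lemma norm_pow_mul_sub_one {x : L} (hx : ‖x - 1‖ < 1) {n : ℕ} (hn : ¬ p ∣ n) (k : ℕ) :
    ‖x ^ (p ^ k * n) - 1‖ = ‖x - 1‖ ^ p ^ k := by
  rw [pow_mul', pow_prime_pow_sub_one, norm_pow, norm_pow_sub_one_of_not_dvd hx hn]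

lemma exists_norm_pow_sub_one {x : L} (hx : ‖x - 1‖ < 1) {n : ℕ} (hn : n ≠ 0) :
    ∃ k, ‖x ^ n - 1‖ = ‖x - 1‖ ^ p ^ k := by
  obtain ⟨k, m, hm, rfl⟩ := Nat.exists_eq_pow_mul_and_not_dvd hn p hp.out.ne_one
  exact ⟨k, norm_pow_mul_sub_one hx hm k⟩

/-- Among `λ - 1, …, λ^(pm) - 1`, the exponents divisible by `p` contribute `p`-th powers of the
factors of the shorter product, and each of the other `(p - 1)m` factors has norm `|λ - 1|`. -/
lemma norm_qRising_prime_mul {lam : L} (h : ‖lam - 1‖ < 1) (m : ℕ) :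
    ‖qRising lam 1 (p * m)‖ = ‖qRising lam 1 m‖ ^ p * ‖lam - 1‖ ^ ((p - 1) * m) := by
  induction m with
  | zero => simp [qRising]
  | succ m ih =>
    obtain ⟨r, hr⟩ : ∃ r, p = r + 1 := ⟨p - 1, by have := hp.out.pos; omega⟩
    have h1 : ‖qRising lam (1 + p * m) p‖ = ‖lam - 1‖ ^ (p - 1) * ‖lam ^ (1 + m) - 1‖ ^ p := by
      have e1 : ∀ i ∈ range r, ‖lam ^ (1 + p * m + i) - 1‖ = ‖lam - 1‖ := fun i hi => by
        refine norm_pow_sub_one_of_not_dvd h fun hd => ?_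
        have hi := mem_range.1 hi
        rw [show 1 + p * m + i = p * m + (i + 1) by ring, Nat.dvd_add_right (dvd_mul_right _ _)] at hd
        exact absurd (Nat.le_of_dvd (by omega) hd) (by omega)
      have e2 : lam ^ (1 + p * m + r) - 1 = (lam ^ (1 + m) - 1) ^ p := by
        have := pow_prime_pow_sub_one (p := p) (lam ^ (1 + m)) 1
        rw [pow_one] at this
        rw [← this, ← pow_mul]; congr 2; rw [add_mul, mul_comm m p]; omega
      have : qRising lam (1 + p * m) p
          = qRising lam (1 + p * m) r * (lam ^ (1 + p * m + r) - 1) := by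
        rw [← qRising_succ, ← hr]
      rw [this, e2, norm_mul, norm_pow, qRising, norm_prod, prod_congr rfl e1, prod_const, card_range,
        show r = p - 1 by omega]
    rw [mul_add, mul_one, qRising_add, norm_mul, ih, h1, qRising_succ, norm_mul]
    ring

lemma norm_qRising_prime_pow_mul_le {lam : L} (h : ‖lam - 1‖ < 1) {m : ℕ} (hm : 0 < m) (k : ℕ) :
    ‖qRising lam 1 (p ^ (k + 1) * m)‖
      ≤ ‖qRising lam 1 m‖ ^ p ^ (k + 1) * ‖lam - 1‖ ^ ((k + 1) * p ^ k) := by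
  have hp1 : 1 ≤ p - 1 := by have := hp.out.two_le; omega
  induction k with
  | zero =>
    simp only [zero_add, pow_one, pow_zero, mul_one]
    rw [norm_qRising_prime_mul h]
    refine mul_le_mul_of_nonneg_left ?_ (by positivity)
    exact pow_le_of_le_one (norm_nonneg _) h.le (by positivity)
  | succ k ih =>
    rw [pow_succ' p (k + 1), mul_assoc, norm_qRising_prime_mul h]
    calc _ ≤ (‖qRising lam 1 m‖ ^ p ^ (k + 1) * ‖lam - 1‖ ^ ((k + 1) * p ^ k)) ^ p
            * ‖lam - 1‖ ^ (p ^ (k + 1)) := by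
          refine mul_le_mul (pow_le_pow_left₀ (norm_nonneg _) ih _) ?_ (by positivity)
            (by positivity)
          refine pow_le_pow_of_le_one (norm_nonneg _) h.le ?_
          calc p ^ (k + 1) = 1 * (p ^ (k + 1) * 1) := by ring
            _ ≤ _ := by gcongr; exact hm
      _ = _ := by
          rw [mul_pow, ← pow_mul, ← pow_mul, mul_assoc, ← pow_add]
          congr 2 <;> ring

end CharP

/-! ### Composition with f, the Poincaré series, and superexponential decay. -/

section Operators

variable {L : Type*} [NormedField L]

/-- The operator `(A - λᵗ)(A - λᵗ⁺¹) ⋯ (A - λᵗ⁺ᵏ⁻¹)`, where `A` is composition with `f`. -/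
noncomputable def shiftProd (f : L[X]) (lam : L) (t : ℕ) : ℕ → L[X] → L[X]
  | 0, G => G
  | k + 1, G => (shiftProd f lam t k G).comp f - C (lam ^ (t + k)) * shiftProd f lam t k G

lemma shiftProd_add (f : L[X]) (lam : L) (t a b : ℕ) (G : L[X]) :
    shiftProd f lam t (a + b) G = shiftProd f lam (t + a) b (shiftProd f lam t a G) := by
  induction b with
  | zero => rfl
  | succ b ih => rw [← add_assoc, shiftProd, shiftProd, ih, add_assoc t a b]

/-- `f` is conjugate to multiplication by `lam` by a convergent power series `ψ`, normalized to
have linear coefficient one. -/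
def HasPoincareSeries (lam : L) (f : L[X]) : Prop :=
  ∃ ψ : PowerSeries L, PowerSeries.coeff 0 ψ = 0 ∧ PowerSeries.coeff 1 ψ = 1 ∧
    (∃ r : ℝ, 0 < r ∧ ∀ n, ‖PowerSeries.coeff (n + 1) ψ‖ ≤ r ^ n) ∧
      aeval ψ f = PowerSeries.rescale lam ψ

lemma coeff_pow_of_lt {ψ : PowerSeries L} (h0 : PowerSeries.coeff 0 ψ = 0) {n i : ℕ} (h : n < i) :
    PowerSeries.coeff n (ψ ^ i) = 0 := by
  refine PowerSeries.X_pow_dvd_iff.1 (pow_dvd_pow_of_dvd (PowerSeries.X_dvd_iff.2 ?_) i) n h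
  simpa using h0

lemma coeff_pow_self {ψ : PowerSeries L} (h0 : PowerSeries.coeff 0 ψ = 0)
    (h1 : PowerSeries.coeff 1 ψ = 1) (i : ℕ) : PowerSeries.coeff i (ψ ^ i) = 1 := by
  obtain ⟨g, rfl⟩ := PowerSeries.X_dvd_iff.2 (by simpa using h0)
  have : PowerSeries.coeff 0 g = 1 := by
    rw [← h1, PowerSeries.coeff_succ_X_mul]
  have h2 := PowerSeries.coeff_mul_X_pow (g ^ i) i 0
  rw [zero_add] at h2
  rw [mul_pow, mul_comm, h2]
  simpa using congrArg (· ^ i) this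

lemma coeff_aeval {ψ : PowerSeries L} (h0 : PowerSeries.coeff 0 ψ = 0) (F : L[X]) (n : ℕ) :
    PowerSeries.coeff n (aeval ψ F)
      = ∑ i ∈ range (n + 1), F.coeff i * PowerSeries.coeff n (ψ ^ i) := by
  have h : F.natDegree < max (F.natDegree + 1) (n + 1) := by omega
  rw [aeval_eq_sum_range' h, map_sum]
  simp only [map_smul, smul_eq_mul]
  refine (sum_subset (range_subset_range.2 (le_max_right _ _)) fun i _ hi => ?_).symm
  rw [coeff_pow_of_lt h0 (by simpa using hi), mul_zero]

/-- Through `ψ`, composition with `f` becomes rescaling by `lam`, which is diagonal on monomials. -/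
lemma aeval_shiftProd {lam : L} {f : L[X]} {ψ : PowerSeries L}
    (hψ : aeval ψ f = PowerSeries.rescale lam ψ) (F : L[X]) (N n : ℕ) :
    PowerSeries.coeff n (aeval ψ (shiftProd f lam 0 N F))
      = qFalling lam N (lam ^ n) * PowerSeries.coeff n (aeval ψ F) := by
  induction N with
  | zero => simp [shiftProd, qFalling]
  | succ N ih =>
    have h1 : aeval ψ ((shiftProd f lam 0 N F).comp f)
        = PowerSeries.rescale lam (aeval ψ (shiftProd f lam 0 N F)) := by
      rw [aeval_comp, hψ]
      rw [← PowerSeries.coe_rescaleAlgHom]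
      exact aeval_algHom_apply (PowerSeries.rescaleAlgHom lam) ψ _
    have h2 : aeval ψ (C (lam ^ (0 + N)) * shiftProd f lam 0 N F)
        = lam ^ N • aeval ψ (shiftProd f lam 0 N F) := by
      rw [← smul_eq_C_mul, map_smul, zero_add]
    rw [shiftProd, map_sub, map_sub, h1, h2, PowerSeries.coeff_rescale, map_smul, ih,
      qFalling_succ, smul_eq_mul]
    ring

lemma norm_coeff_le_inv_mul {r : ℝ} (hr : 0 < r) {ψ : PowerSeries L}
    (h0 : PowerSeries.coeff 0 ψ = 0) (h : ∀ n, ‖PowerSeries.coeff (n + 1) ψ‖ ≤ r ^ n) (n : ℕ) :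
    ‖PowerSeries.coeff n ψ‖ ≤ r⁻¹ * r ^ n := by
  cases n with
  | zero => rw [h0]; simpa using hr.le
  | succ n => rw [pow_succ', inv_mul_cancel_left₀ hr.ne']; exact h n

variable [IsUltrametricDist L]

lemma norm_coeff_mul_le {r A B : ℝ} (hr : 0 < r) (hA : 0 ≤ A) (hB : 0 ≤ B) {F G : PowerSeries L}
    (hF : ∀ n, ‖PowerSeries.coeff n F‖ ≤ A * r ^ n) (hG : ∀ n, ‖PowerSeries.coeff n G‖ ≤ B * r ^ n)
    (n : ℕ) : ‖PowerSeries.coeff n (F * G)‖ ≤ A * B * r ^ n := by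
  rw [PowerSeries.coeff_mul]
  refine IsUltrametricDist.norm_sum_le_of_forall_le_of_nonneg (by positivity) fun x hx => ?_
  rw [norm_mul, ← mem_antidiagonal.1 hx, pow_add, mul_mul_mul_comm]
  exact mul_le_mul (hF _) (hG _) (norm_nonneg _) (by positivity)

lemma norm_coeff_pow_le {r A : ℝ} (hr : 0 < r) (hA : 0 ≤ A) {F : PowerSeries L}
    (hF : ∀ n, ‖PowerSeries.coeff n F‖ ≤ A * r ^ n) (i n : ℕ) :
    ‖PowerSeries.coeff n (F ^ i)‖ ≤ A ^ i * r ^ n := by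
  induction i generalizing n with
  | zero =>
    rw [pow_zero, PowerSeries.coeff_one]
    split_ifs with h <;> simp [h]
    positivity
  | succ i ih =>
    rw [pow_succ, pow_succ]
    exact norm_coeff_mul_le hr (by positivity) hA ih hF n

/-- A series `T` is bounded by the bounds on `ψ` and on the composition of `T` with `ψ`. -/
lemma norm_le_of_triangular {r B : ℝ} (hr : 0 < r) (hB : 0 ≤ B) {ψ : PowerSeries L}
    (h0 : PowerSeries.coeff 0 ψ = 0) (h1 : PowerSeries.coeff 1 ψ = 1)
    (hψ : ∀ n, ‖PowerSeries.coeff (n + 1) ψ‖ ≤ r ^ n) (T : ℕ → L)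
    (hT : ∀ n, ‖∑ i ∈ range (n + 1), T i * PowerSeries.coeff n (ψ ^ i)‖ ≤ B * r ^ n) (n : ℕ) :
    ‖T n‖ ≤ B * r ^ n := by
  induction n using Nat.strong_induction_on with
  | _ n ih =>
    have h := hT n
    rw [sum_range_succ, coeff_pow_self h0 h1, mul_one] at h
    rw [← add_sub_cancel_left (∑ i ∈ range n, T i * PowerSeries.coeff n (ψ ^ i)) (T n)]
    refine norm_sub_le_of_le h ?_
    refine IsUltrametricDist.norm_sum_le_of_forall_le_of_nonneg (by positivity) fun i hi => ?_
    rw [norm_mul]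
    calc _ ≤ B * r ^ i * (r⁻¹ ^ i * r ^ n) := by
          refine mul_le_mul (ih i (mem_range.1 hi)) ?_ (norm_nonneg _) (by positivity)
          exact norm_coeff_pow_le hr (by positivity) (norm_coeff_le_inv_mul hr h0 hψ) i n
      _ = B * r ^ n := by
          rw [inv_pow]; field_simp

/-- The diagonal form bounds the series after substitution of `ψ`; substitution is unipotent
triangular, so the bound passes back to the polynomial. The constants do not depend on `N`. -/
lemma HasPoincareSeries.exists_norm_coeff_shiftProd_le {lam : L} {f : L[X]}
    (hf : HasPoincareSeries lam f) (hlam : ‖lam‖ = 1) (F : L[X]) :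
    ∃ B r : ℝ, 0 ≤ B ∧ 0 < r ∧ ∀ N n,
      ‖(shiftProd f lam 0 N F).coeff n‖ ≤ B * r ^ n * ‖qRising lam 1 N‖ := by
  obtain ⟨ψ, h0, h1, ⟨r, hr, hψ⟩, hfψ⟩ := hf
  have hb : ∃ B : ℝ, 0 ≤ B ∧ ∀ n, ‖PowerSeries.coeff n (aeval ψ F)‖ ≤ B * r ^ n := by
    induction F using Polynomial.induction_on' with
    | add P Q hP hQ =>
      obtain ⟨B, hB, hBP⟩ := hP
      obtain ⟨B', hB', hBQ⟩ := hQ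
      refine ⟨max B B', le_max_of_le_left hB, fun n => ?_⟩
      rw [map_add, map_add]
      exact norm_add_le_of_le
        ((hBP n).trans (mul_le_mul_of_nonneg_right (le_max_left _ _) (by positivity)))
        ((hBQ n).trans (mul_le_mul_of_nonneg_right (le_max_right _ _) (by positivity)))
    | monomial i a =>
      refine ⟨‖a‖ * r⁻¹ ^ i, by positivity, fun n => ?_⟩
      rw [aeval_monomial, ← Algebra.smul_def, map_smul, norm_smul, mul_assoc]
      exact mul_le_mul_of_nonneg_left (norm_coeff_pow_le hr (by positivity)
        (norm_coeff_le_inv_mul hr h0 hψ) i n) (norm_nonneg _)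
  obtain ⟨B, hB, hBF⟩ := hb
  refine ⟨B, r, hB, hr, fun N n => ?_⟩
  rw [mul_right_comm]
  refine norm_le_of_triangular hr (by positivity) h0 h1 hψ _ (fun n => ?_) n
  rw [← coeff_aeval h0, aeval_shiftProd hfψ, norm_mul, mul_comm, mul_right_comm]
  exact mul_le_mul (hBF n) (norm_qFalling_pow_le hlam N n) (norm_nonneg _) (by positivity)

/-- The iterated products of `A - λⁱ` on a polynomial decay superexponentially if `f` has a
Poincaré series. -/
lemma HasPoincareSeries.not_pow_le {p : ℕ} [hp : Fact p.Prime] [CharP L p] {lam : L} {f : L[X]}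
    (hf : HasPoincareSeries lam f) (hlam : ‖lam - 1‖ < 1) {m : ℕ} (hm : 0 < m) {F : L[X]}
    {e₀ e₁ : ℕ} {θ : ℝ} (hθ : 0 < θ) :
    ¬ ∀ N, θ ^ N ≤ ‖(shiftProd f lam 0 (N * m) F).coeff (e₀ + N * e₁)‖ := by
  intro h
  obtain ⟨B, r, hB, hr, hBr⟩ :=
    hf.exists_norm_coeff_shiftProd_le (norm_eq_one_of_norm_sub_one_lt hlam) F
  obtain ⟨k, hk⟩ := exists_mul_pow_lt_one (norm_nonneg (lam - 1)) hlam (B := B * r ^ e₀)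
    (D := r ^ e₁ * ‖qRising lam 1 m‖ / θ) (by positivity) (by positivity) hp.out.one_lt
  have h1 := (h (p ^ (k + 1))).trans (hBr _ _)
  have h2 := norm_qRising_prime_pow_mul_le (p := p) hlam hm k
  have h3 : θ ^ p ^ (k + 1) ≤ B * r ^ (e₀ + p ^ (k + 1) * e₁) *
      (‖qRising lam 1 m‖ ^ p ^ (k + 1) * ‖lam - 1‖ ^ ((k + 1) * p ^ k)) :=
    h1.trans (mul_le_mul_of_nonneg_left h2 (by positivity))
  have h4 : B * r ^ (e₀ + p ^ (k + 1) * e₁) *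
      (‖qRising lam 1 m‖ ^ p ^ (k + 1) * ‖lam - 1‖ ^ ((k + 1) * p ^ k))
      = θ ^ p ^ (k + 1) * (B * r ^ e₀ * (r ^ e₁ * ‖qRising lam 1 m‖ / θ) ^ p ^ (k + 1)
        * ‖lam - 1‖ ^ ((k + 1) * p ^ k)) := by
    rw [div_pow, mul_pow, pow_add, ← pow_mul r e₁, mul_comm e₁]
    field_simp
  rw [h4] at h3
  exact absurd h3 (not_le.2 (mul_lt_of_lt_one_right (by positivity) hk))

end Operators

/-! ### q-binomial operators: Leibniz and Vandermonde identities. -/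

section QuantumDifference

variable {L : Type*} [NormedField L]

/-- The `q`-binomial operator `∏_{i<m} (A - λⁱ) / ∏_{1≤i≤m} (λⁱ - 1)`, where `A` is composition
with `f`. -/
noncomputable def qBinom (f : L[X]) (lam : L) : ℕ → L[X] →ₗ[L] L[X]
  | 0 => LinearMap.id
  | m + 1 => (lam ^ (m + 1) - 1)⁻¹ •
      ((aeval f).toLinearMap ∘ₗ qBinom f lam m - lam ^ m • qBinom f lam m)

variable {f : L[X]} {lam : L}

@[simp] lemma qBinom_zero (F : L[X]) : qBinom f lam 0 F = F := rfl

lemma qBinom_succ (m : ℕ) (F : L[X]) : qBinom f lam (m + 1) F = (lam ^ (m + 1) - 1)⁻¹ •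
    (aeval f (qBinom f lam m F) - lam ^ m • qBinom f lam m F) := rfl

lemma aeval_qBinom (hroot : ∀ n : ℕ, 0 < n → lam ^ n ≠ 1) (m : ℕ) (F : L[X]) :
    aeval f (qBinom f lam m F)
      = (lam ^ (m + 1) - 1) • qBinom f lam (m + 1) F + lam ^ m • qBinom f lam m F := by
  rw [qBinom_succ, smul_inv_smul₀ (sub_ne_zero.2 (hroot _ m.succ_pos)), sub_add_cancel]

lemma qBinom_aeval (m : ℕ) (F : L[X]) :
    qBinom f lam m (aeval f F) = aeval f (qBinom f lam m F) := by
  induction m with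
  | zero => rfl
  | succ m ih => rw [qBinom_succ, qBinom_succ, ih, map_smul, map_sub, map_smul]

lemma qBinom_one {m : ℕ} (hm : 0 < m) : qBinom f lam m 1 = 0 := by
  induction m, hm using Nat.le_induction with
  | base => simp [qBinom_succ]
  | succ m _ ih => simp [qBinom_succ, ih]

lemma coeff_zero_qBinom (hf : f.coeff 0 = 0) (m : ℕ) {F : L[X]} (hF : F.coeff 0 = 0) :
    (qBinom f lam m F).coeff 0 = 0 := by
  induction m with
  | zero => exact hF
  | succ m ih =>
    have h : (aeval f (qBinom f lam m F)).coeff 0 = 0 := by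
      rw [← comp_eq_aeval, coeff_zero_eq_eval_zero, eval_comp, ← coeff_zero_eq_eval_zero, hf,
        ← coeff_zero_eq_eval_zero, ih]
    simp [qBinom_succ, h, ih]

/-- The `q`-Leibniz rule. Since `A` is a ring homomorphism, the induction reduces to splitting
`λ^(i+j) - 1 = (λʲ - 1) + λʲ(λⁱ - 1)`. -/
lemma qBinom_mul (hroot : ∀ n : ℕ, 0 < n → lam ^ n ≠ 1) (m : ℕ) (F G : L[X]) :
    qBinom f lam m (F * G) = ∑ x ∈ antidiagonal m,
      ((aeval f : L[X] →ₐ[L] L[X]) ^ x.2) (qBinom f lam x.1 F) * qBinom f lam x.2 G := by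
  induction m with
  | zero => simp
  | succ m ih =>
    set A : L[X] →ₐ[L] L[X] := aeval f with hA
    have h0 : lam ^ (m + 1) - 1 ≠ 0 := sub_ne_zero.2 (hroot _ m.succ_pos)
    set T : ℕ → ℕ → L[X] := fun i j => (A ^ j) (qBinom f lam i F) * qBinom f lam j G with hT
    have step : ∀ i j, A (T i j) = (lam ^ (j + 1) - 1) • T i (j + 1)
        + (lam ^ j * (lam ^ (i + 1) - 1)) • T (i + 1) j + lam ^ (i + j) • T i j := fun i j => by
      have e : A ((A ^ j) (qBinom f lam i F)) = (A ^ j) (A (qBinom f lam i F)) := by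
        rw [← AlgHom.mul_apply, ← AlgHom.mul_apply, (Commute.self_pow A j).eq]
      have e2 : (A ^ (j + 1)) (qBinom f lam i F) = (A ^ j) (A (qBinom f lam i F)) := by
        rw [pow_succ, AlgHom.mul_apply]
      simp only [hT]
      rw [map_mul, e2, e, hA, aeval_qBinom hroot j, aeval_qBinom hroot i, ← hA, map_add, map_smul,
        map_smul]
      simp only [smul_eq_C_mul, map_sub, map_mul, map_pow, map_one]
      ring
    have h1 : (lam ^ (m + 1) - 1) • ∑ x ∈ antidiagonal (m + 1), T x.1 x.2
        = ∑ x ∈ antidiagonal (m + 1), (lam ^ x.2 - 1) • T x.1 x.2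
          + ∑ x ∈ antidiagonal (m + 1), (lam ^ x.2 * (lam ^ x.1 - 1)) • T x.1 x.2 := by
      rw [smul_sum, ← sum_add_distrib]
      refine sum_congr rfl fun x hx => ?_
      rw [← add_smul, ← mem_antidiagonal.1 hx]
      congr 1; ring
    rw [Nat.sum_antidiagonal_succ' (f := fun x => (lam ^ x.2 - 1) • T x.1 x.2),
      Nat.sum_antidiagonal_succ (f := fun x => (lam ^ x.2 * (lam ^ x.1 - 1)) • T x.1 x.2)] at h1
    simp only [pow_zero, sub_self, zero_smul, mul_zero, zero_add] at h1
    rw [qBinom_succ, inv_smul_eq_iff₀ h0, h1, ih, map_sum, smul_sum, ← sum_sub_distrib,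
      ← sum_add_distrib]
    refine sum_congr rfl fun x hx => ?_
    have := step x.1 x.2
    rw [mem_antidiagonal.1 hx] at this
    rw [this, add_sub_cancel_right]

/-- A `q`-Vandermonde expansion: starting the product at `lam ^ t` instead of `1` only adds integral
multiples of lower `q`-binomials. -/
lemma exists_shiftProd_eq [IsUltrametricDist L] (hroot : ∀ n : ℕ, 0 < n → lam ^ n ≠ 1)
    (hlam : ‖lam‖ = 1) (t : ℕ) :
    ∃ β : ℕ → L, β 0 = 1 ∧ (∀ j, ‖β j‖ ≤ 1) ∧ ∀ m G, shiftProd f lam t m G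
      = qRising lam 1 m • ∑ x ∈ antidiagonal m, β x.2 • qBinom f lam x.1 G := by
  refine ⟨fun j => (-1) ^ j * qRising lam t j / qRising lam 1 j, by simp [qRising], fun j => ?_,
    fun m G => ?_⟩
  · rw [norm_div, norm_mul, norm_pow, norm_neg, norm_one, one_pow, one_mul]
    exact div_le_one_of_le₀ (norm_qRising_le hlam _ _) (norm_nonneg _)
  set β : ℕ → L := fun j => (-1) ^ j * qRising lam t j / qRising lam 1 j with hβ
  have hrec : ∀ j, (lam ^ (j + 1) - 1) * β (j + 1) = (1 - lam ^ (t + j)) * β j := fun j => by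
    have h1 := qRising_one_ne_zero hroot j
    have h2 : lam ^ (1 + j) - 1 ≠ 0 := sub_ne_zero.2 (hroot _ (by omega))
    simp only [hβ, qRising_succ]
    rw [add_comm j 1]
    field_simp
    ring
  induction m with
  | zero => simp [shiftProd, qRising, hβ]
  | succ m ih =>
    have h1 : (lam ^ (m + 1) - 1) • ∑ x ∈ antidiagonal (m + 1), β x.2 • qBinom f lam x.1 G
        = ∑ x ∈ antidiagonal (m + 1), (lam ^ x.1 - 1) • β x.2 • qBinom f lam x.1 G
          + ∑ x ∈ antidiagonal (m + 1),
            (lam ^ x.1 * (lam ^ x.2 - 1)) • β x.2 • qBinom f lam x.1 G := by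
      rw [smul_sum, ← sum_add_distrib]
      refine sum_congr rfl fun x hx => ?_
      rw [← add_smul, ← mem_antidiagonal.1 hx]
      congr 1; ring
    rw [Nat.sum_antidiagonal_succ
        (f := fun x => (lam ^ x.1 - 1) • β x.2 • qBinom f lam x.1 G),
      Nat.sum_antidiagonal_succ'
        (f := fun x => (lam ^ x.1 * (lam ^ x.2 - 1)) • β x.2 • qBinom f lam x.1 G)] at h1
    simp only [pow_zero, sub_self, zero_smul, mul_zero, zero_add] at h1
    rw [shiftProd, qRising_succ, mul_smul, add_comm 1 m, h1, ih, comp_eq_aeval, map_smul,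
      ← smul_eq_C_mul, smul_comm (lam ^ (t + m)), ← smul_sub, map_sum, smul_sum,
      ← sum_sub_distrib, ← sum_add_distrib]
    congr 1
    refine sum_congr rfl fun x hx => ?_
    rw [map_smul, aeval_qBinom hroot, ← mem_antidiagonal.1 hx, mul_smul,
      smul_smul (lam ^ (x.2 + 1) - 1), hrec]
    simp only [smul_eq_C_mul, map_sub, map_mul, map_pow, map_one]
    ring

end QuantumDifference

/-! ### The Gauss norm on polynomials. -/

section CoeffBound

variable {L : Type*} [NormedField L]

/-- All coefficients of `F` have norm at most `B`. -/
def CoeffLE (B : ℝ) (F : L[X]) : Prop := ∀ i, ‖F.coeff i‖ ≤ B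

lemma CoeffLE.nonneg {B : ℝ} {F : L[X]} (h : CoeffLE B F) : 0 ≤ B := (norm_nonneg _).trans (h 0)

lemma CoeffLE.mono {B B' : ℝ} {F : L[X]} (h : CoeffLE B F) (hB : B ≤ B') : CoeffLE B' F :=
  fun i => (h i).trans hB

lemma CoeffLE.smul {B : ℝ} {F : L[X]} (h : CoeffLE B F) (c : L) : CoeffLE (‖c‖ * B) (c • F) :=
  fun i => by
    rw [coeff_smul, norm_smul]
    exact mul_le_mul_of_nonneg_left (h i) (norm_nonneg _)

lemma CoeffLE.of_smul {B : ℝ} {F : L[X]} {c : L} (hc : c ≠ 0) (h : CoeffLE (‖c‖ * B) (c • F)) :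
    CoeffLE B F := fun i => by
  have := h i
  rw [coeff_smul, norm_smul] at this
  exact le_of_mul_le_mul_left this (norm_pos_iff.2 hc)

lemma coeffLE_zero {B : ℝ} (hB : 0 ≤ B) : CoeffLE B (0 : L[X]) := fun i => by simpa using hB

lemma coeffLE_X_pow (n : ℕ) : CoeffLE 1 (X ^ n : L[X]) := fun i => by
  rw [coeff_X_pow]
  split_ifs <;> simp

lemma coeffLE_X : CoeffLE 1 (X : L[X]) := by simpa using coeffLE_X_pow (L := L) 1

lemma coeffLE_C (c : L) : CoeffLE ‖c‖ (C c) := fun i => by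
  rw [coeff_C]
  split_ifs <;> simp

variable [IsUltrametricDist L]

lemma CoeffLE.add {B : ℝ} {F G : L[X]} (hF : CoeffLE B F) (hG : CoeffLE B G) :
    CoeffLE B (F + G) := fun i => by
  rw [coeff_add]
  exact norm_add_le_of_le (hF i) (hG i)

lemma CoeffLE.sub {B : ℝ} {F G : L[X]} (hF : CoeffLE B F) (hG : CoeffLE B G) :
    CoeffLE B (F - G) := fun i => by
  rw [coeff_sub]
  exact norm_sub_le_of_le (hF i) (hG i)

lemma coeffLE_sum {ι : Type*} {s : Finset ι} {F : ι → L[X]} {B : ℝ} (hB : 0 ≤ B)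
    (h : ∀ i ∈ s, CoeffLE B (F i)) : CoeffLE B (∑ i ∈ s, F i) := fun n => by
  rw [finsetSum_coeff]
  exact IsUltrametricDist.norm_sum_le_of_forall_le_of_nonneg hB fun i hi => h i hi n

lemma CoeffLE.mul {A B : ℝ} {F G : L[X]} (hF : CoeffLE A F) (hG : CoeffLE B G) :
    CoeffLE (A * B) (F * G) := fun n => by
  rw [coeff_mul]
  refine IsUltrametricDist.norm_sum_le_of_forall_le_of_nonneg
    (mul_nonneg hF.nonneg hG.nonneg) fun x _ => ?_
  rw [norm_mul]
  exact mul_le_mul (hF _) (hG _) (norm_nonneg _) hF.nonneg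

lemma CoeffLE.mul_one {B : ℝ} {F G : L[X]} (hF : CoeffLE B F) (hG : CoeffLE 1 G) :
    CoeffLE B (F * G) := by simpa using hF.mul hG

lemma CoeffLE.one_mul {B : ℝ} {F G : L[X]} (hF : CoeffLE 1 F) (hG : CoeffLE B G) :
    CoeffLE B (F * G) := by simpa using hF.mul hG

lemma CoeffLE.pow {F : L[X]} (hF : CoeffLE 1 F) (n : ℕ) : CoeffLE 1 (F ^ n) := by
  induction n with
  | zero => simpa using coeffLE_X_pow (L := L) 0
  | succ n ih => rw [pow_succ]; exact ih.mul_one hF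

lemma norm_natCast_le_one' (n : ℕ) : ‖(n : L)‖ ≤ 1 := IsUltrametricDist.norm_natCast_le_one L n

lemma CoeffLE.derivative {B : ℝ} {F : L[X]} (hF : CoeffLE B F) :
    CoeffLE B (Polynomial.derivative F) := fun n => by
  rw [coeff_derivative, norm_mul]
  have h : ‖((n : L) + 1)‖ ≤ 1 := by exact_mod_cast norm_natCast_le_one' (L := L) (n + 1)
  exact (mul_le_of_le_one_right (norm_nonneg _) h).trans (hF _)

lemma CoeffLE.norm_eval_le {B : ℝ} {F : L[X]} (hF : CoeffLE B F) {x : L} (hx : ‖x‖ ≤ 1) :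
    ‖F.eval x‖ ≤ B := by
  rw [eval_eq_sum_range]
  refine IsUltrametricDist.norm_sum_le_of_forall_le_of_nonneg hF.nonneg fun i _ => ?_
  rw [norm_mul, norm_pow]
  exact (mul_le_of_le_one_right (norm_nonneg _) (pow_le_one₀ (norm_nonneg _) hx)).trans (hF _)

/-- A linear map which is bounded on monomials is bounded. -/
lemma CoeffLE.map {τ B : ℝ} {T : L[X] →ₗ[L] L[X]} (hT : ∀ n, CoeffLE τ (T (X ^ n))) {F : L[X]}
    (hF : CoeffLE B F) : CoeffLE (τ * B) (T F) := by
  have hτ := (hT 0).nonneg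
  rw [F.as_sum_range_C_mul_X_pow, map_sum]
  refine coeffLE_sum (mul_nonneg hτ hF.nonneg) fun i _ => ?_
  rw [← smul_eq_C_mul, map_smul]
  refine ((hT i).smul _).mono ?_
  rw [mul_comm]
  exact mul_le_mul_of_nonneg_left (hF i) hτ

/-- A linear map which is approximately a derivation is approximately a vector field. -/
lemma CoeffLE.map_sub_derivative_mul {τ B : ℝ} {T : L[X] →ₗ[L] L[X]} (h1 : T 1 = 0)
    (hT : ∀ n, CoeffLE τ (T (X ^ (n + 1)) - X * T (X ^ n) - X ^ n * T X)) {F : L[X]}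
    (hF : CoeffLE B F) : CoeffLE (τ * B) (T F - Polynomial.derivative F * T X) := by
  refine CoeffLE.map
    (T := T - (LinearMap.mulRight L (T X)) ∘ₗ Polynomial.derivative) (fun n => ?_) hF
  simp only [LinearMap.sub_apply, LinearMap.comp_apply, LinearMap.mulRight_apply]
  induction n with
  | zero => simpa [h1] using coeffLE_zero (hT 0).nonneg
  | succ n ih =>
    have e : T (X ^ (n + 1)) - Polynomial.derivative (X ^ (n + 1)) * T X
        = (T (X ^ (n + 1)) - X * T (X ^ n) - X ^ n * T X)
          + X * (T (X ^ n) - Polynomial.derivative (X ^ n) * T X) := by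
      rw [pow_succ, derivative_mul, derivative_X]; ring
    rw [e]
    exact (hT n).add (coeffLE_X.one_mul ih)

end CoeffBound

/-! ### Operators close to vector fields. -/

section Extension

variable {L : Type*} [NormedField L] [IsUltrametricDist L] {f g : L[X]} {lam : L}

lemma CoeffLE.aeval {B : ℝ} (hf : CoeffLE 1 f) {F : L[X]} (hF : CoeffLE B F) :
    CoeffLE B (Polynomial.aeval f F) := by
  have := CoeffLE.map (τ := 1) (T := (Polynomial.aeval f : L[X] →ₐ[L] L[X]).toLinearMap)
    (fun n => by simpa using hf.pow n) hF
  simpa using this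

lemma CoeffLE.aeval_pow {B : ℝ} (hf : CoeffLE 1 f) {F : L[X]} (hF : CoeffLE B F) (j : ℕ) :
    CoeffLE B (((Polynomial.aeval f : L[X] →ₐ[L] L[X]) ^ j) F) := by
  induction j with
  | zero => simpa using hF
  | succ j ih => rw [pow_succ', AlgHom.mul_apply]; exact hf.aeval ih

lemma CoeffLE.aeval_sub {B δ : ℝ} (hf : CoeffLE 1 f) (hδ : CoeffLE δ (f - X)) {F : L[X]}
    (hF : CoeffLE B F) : CoeffLE (δ * B) (Polynomial.aeval f F - F) := by
  refine CoeffLE.map (τ := δ)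
    (T := (Polynomial.aeval f : L[X] →ₐ[L] L[X]).toLinearMap - LinearMap.id) (fun n => ?_) hF
  simp only [LinearMap.sub_apply, AlgHom.toLinearMap_apply, map_pow, aeval_X, LinearMap.id_apply]
  induction n with
  | zero => simpa using coeffLE_zero hδ.nonneg
  | succ n ih =>
    have : f ^ (n + 1) - X ^ (n + 1) = (f ^ n - X ^ n) * f + X ^ n * (f - X) := by ring
    rw [this]
    exact (ih.mul_one hf).add ((coeffLE_X_pow n).one_mul hδ)

lemma CoeffLE.aeval_pow_sub {B δ : ℝ} (hf : CoeffLE 1 f) (hδ : CoeffLE δ (f - X)) {F : L[X]}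
    (hF : CoeffLE B F) (j : ℕ) :
    CoeffLE (δ * B) (((Polynomial.aeval f : L[X] →ₐ[L] L[X]) ^ j) F - F) := by
  induction j with
  | zero => simpa using coeffLE_zero (mul_nonneg hδ.nonneg hF.nonneg)
  | succ j ih =>
    rw [pow_succ', AlgHom.mul_apply, ← sub_add_sub_cancel]
    exact (hf.aeval_sub hδ (hf.aeval_pow hF j)).add ih

/-- First order Taylor expansion of `F ∘ f` where `f` is close to the identity. -/
lemma CoeffLE.aeval_taylor {B δ : ℝ} (hf : CoeffLE 1 f) (hδ : CoeffLE δ (f - X)) {F : L[X]}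
    (hF : CoeffLE B F) :
    CoeffLE (δ * δ * B) (Polynomial.aeval f F - F - Polynomial.derivative F * (f - X)) := by
  have h := CoeffLE.map_sub_derivative_mul (τ := δ * δ) (B := B)
    (T := (Polynomial.aeval f : L[X] →ₐ[L] L[X]).toLinearMap - LinearMap.id) (by simp)
    (fun n => ?_) hF
  · simpa using h
  · simp only [LinearMap.sub_apply, AlgHom.toLinearMap_apply, map_pow, aeval_X,
      LinearMap.id_apply]
    have e : f ^ (n + 1) - X ^ (n + 1) - X * (f ^ n - X ^ n) - X ^ n * (f - X)
        = (f - X) * (f ^ n - X ^ n) := by ring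
    rw [e]
    refine hδ.mul ?_
    have := hf.aeval_sub hδ (coeffLE_X_pow n)
    simpa using this

/-- In the `q`-Leibniz expansion of `X ^ n * X`, order `m` occurs in only one factor of a term, the
other then having order `0`; hence the bound `M` does not compound with `n`. -/
lemma coeffLE_qBinom_X_pow (hroot : ∀ n : ℕ, 0 < n → lam ^ n ≠ 1) (hf : CoeffLE 1 f) {M : ℝ}
    (hM : 1 ≤ M) {m : ℕ} (hm : 0 < m) (hlt : ∀ j < m, CoeffLE 1 (qBinom f lam j X))
    (ha : CoeffLE M (qBinom f lam m X)) (n : ℕ) :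
    (∀ j < m, CoeffLE 1 (qBinom f lam j (X ^ n))) ∧ CoeffLE M (qBinom f lam m (X ^ n)) := by
  induction n with
  | zero =>
    refine ⟨fun j _ => ?_, ?_⟩
    · rcases Nat.eq_zero_or_pos j with rfl | hj
      · simpa using coeffLE_X_pow (L := L) 0
      · rw [pow_zero, qBinom_one hj]; exact coeffLE_zero zero_le_one
    · rw [pow_zero, qBinom_one hm]; exact coeffLE_zero (by linarith)
  | succ n ih =>
    refine ⟨fun j hj => ?_, ?_⟩
    · rw [pow_succ, qBinom_mul hroot]
      refine coeffLE_sum zero_le_one fun x hx => ?_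
      have hx := mem_antidiagonal.1 hx
      exact (hf.aeval_pow (ih.1 _ (by omega)) _).mul_one (hlt _ (by omega))
    · rw [pow_succ, qBinom_mul hroot]
      refine coeffLE_sum (by linarith) fun x hx => ?_
      have hx := mem_antidiagonal.1 hx
      rcases Nat.eq_zero_or_pos x.1 with h0 | h0
      · have h2 : x.2 = m := by omega
        rw [h2, h0]
        exact (hf.aeval_pow (ih.1 _ hm) _).one_mul ha
      · have h2 := hlt x.2 (by omega)
        rcases Nat.lt_or_ge x.1 m with h1 | h1
        · exact ((hf.aeval_pow (ih.1 _ h1) _).mul_one h2).mono hM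
        · rw [show x.1 = m by omega]
          exact (hf.aeval_pow ih.2 _).mul_one h2

/-- If the `q`-binomials of smaller order are integral on the coordinate, then the `q`-binomial of
order `m` is approximately a vector field. -/
lemma coeffLE_qBinom_sub (hroot : ∀ n : ℕ, 0 < n → lam ^ n ≠ 1) (hf : CoeffLE 1 f) {M δ : ℝ}
    (hδ : CoeffLE δ (f - X)) (hM : 1 ≤ M) {m : ℕ} (hm : 0 < m)
    (hlt : ∀ j < m, CoeffLE 1 (qBinom f lam j X)) (ha : CoeffLE M (qBinom f lam m X)) {B : ℝ}
    {F : L[X]} (hF : CoeffLE B F) :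
    CoeffLE (max 1 (δ * M) * B) (qBinom f lam m F - derivative F * qBinom f lam m X) := by
  refine CoeffLE.map_sub_derivative_mul (qBinom_one hm) (fun n => ?_) hF
  have hn := coeffLE_qBinom_X_pow hroot hf hM hm hlt ha n
  have h1 : (m, 0) ∈ antidiagonal m := by simp
  have h2 : (0, m) ∈ (antidiagonal m).erase (m, 0) := by simp; omega
  rw [pow_succ, qBinom_mul hroot, ← add_sum_erase _ _ h1, ← add_sum_erase _ _ h2]
  simp only [pow_zero, AlgHom.one_apply, qBinom_zero]
  set A : L[X] →ₐ[L] L[X] := aeval f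
  set S := ∑ x ∈ ((antidiagonal m).erase (m, 0)).erase (0, m),
    (A ^ x.2) (qBinom f lam x.1 (X ^ n)) * qBinom f lam x.2 X with hS
  have e : qBinom f lam m (X ^ n) * X + ((A ^ m) (X ^ n) * qBinom f lam m X + S)
      - X * qBinom f lam m (X ^ n) - X ^ n * qBinom f lam m X
      = ((A ^ m) (X ^ n) - X ^ n) * qBinom f lam m X + S := by ring
  rw [e]
  refine CoeffLE.add ?_ ?_
  · have := (hf.aeval_pow_sub hδ (coeffLE_X_pow n) m).mul ha
    rw [_root_.mul_one] at this
    exact this.mono (le_max_right _ _)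
  · refine (coeffLE_sum zero_le_one fun x hx => ?_).mono (le_max_left _ _)
    simp only [mem_erase, ne_eq, Prod.ext_iff, HasAntidiagonal.mem_antidiagonal] at hx
    exact (hf.aeval_pow (hn.1 _ (by omega)) _).mul_one (hlt _ (by omega))

end Extension

/-! ### Integrality of q-binomials from the decay. -/

section Integrality

variable {L : Type*} [NormedField L]

lemma exists_first_max_coeff {a : L[X]} (ha : ¬ CoeffLE 1 a) :
    ∃ (M : ℝ) (d : ℕ), 1 < M ∧ CoeffLE M a ∧ ‖a.coeff d‖ = M ∧ ∀ i < d, ‖a.coeff i‖ < M := by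
  classical
  obtain ⟨k, _, hk⟩ := exists_max_image (range (a.natDegree + 1)) (fun i => ‖a.coeff i‖)
    ⟨0, by simp⟩
  have hM : CoeffLE ‖a.coeff k‖ a := fun i => by
    rcases Nat.lt_or_ge a.natDegree i with h | h
    · simp [coeff_eq_zero_of_natDegree_lt h]
    · exact hk i (mem_range.2 (by omega))
  have hex : ∃ d, ‖a.coeff d‖ = ‖a.coeff k‖ := ⟨k, rfl⟩
  refine ⟨‖a.coeff k‖, Nat.find hex, ?_, hM, Nat.find_spec hex, fun i hi =>
    lt_of_le_of_ne (hM i) (Nat.find_min hex hi)⟩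
  by_contra h
  exact ha (hM.mono (not_lt.1 h))

variable [IsUltrametricDist L] {f g : L[X]} {lam : L}

/-- The first index of maximal coefficient of a vector field `a ∂` which approximately commutes
with `g ∂ = (X + ⋯) ∂` is congruent to one modulo the characteristic. -/
lemma norm_index_mul_lt {M : ℝ} {a : L[X]} {e : ℕ} (hM : 0 < M) (hg : CoeffLE 1 g)
    (hg0 : g.coeff 0 = 0) (hg1 : g.coeff 1 = 1)
    (hlt : ∀ i < e + 1, ‖a.coeff i‖ < M)
    (hcomm : ‖(derivative a * g - derivative g * a).coeff (e + 1)‖ < M) :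
    ‖(e : L) * a.coeff (e + 1)‖ < M := by
  have hnat : ∀ i : ℕ, ‖(i : L) + 1‖ ≤ 1 := fun i => by
    exact_mod_cast norm_natCast_le_one' (L := L) (i + 1)
  have h1 : ‖(derivative a * g).coeff (e + 1) - ((e : L) + 1) * a.coeff (e + 1)‖ < M := by
    have hm : (e, 1) ∈ antidiagonal (e + 1) := by simp
    rw [coeff_mul, ← add_sum_erase _ _ hm, coeff_derivative, hg1, mul_one,
      mul_comm (a.coeff (e + 1)), add_sub_cancel_left]
    refine norm_sum_lt_of_lt hM fun x hx => ?_
    simp only [mem_erase, ne_eq, Prod.ext_iff, HasAntidiagonal.mem_antidiagonal] at hx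
    rcases Nat.eq_zero_or_pos x.2 with h0 | h0
    · simpa [h0, hg0] using hM
    · rw [coeff_derivative, norm_mul, norm_mul]
      calc ‖a.coeff (x.1 + 1)‖ * ‖(x.1 : L) + 1‖ * ‖g.coeff x.2‖
          ≤ ‖a.coeff (x.1 + 1)‖ * 1 * 1 := by gcongr <;> [exact hnat _; exact hg _]
        _ < M := by simpa using hlt (x.1 + 1) (by omega)
  have h2 : ‖(derivative g * a).coeff (e + 1) - a.coeff (e + 1)‖ < M := by
    have hm : (0, e + 1) ∈ antidiagonal (e + 1) := by simp
    rw [coeff_mul, ← add_sum_erase _ _ hm, coeff_derivative, zero_add, hg1]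
    simp only [Nat.cast_zero, zero_add, mul_one, one_mul, add_sub_cancel_left]
    refine norm_sum_lt_of_lt hM fun x hx => ?_
    simp only [mem_erase, ne_eq, Prod.ext_iff, HasAntidiagonal.mem_antidiagonal] at hx
    rw [norm_mul]
    calc ‖(derivative g).coeff x.1‖ * ‖a.coeff x.2‖ ≤ 1 * ‖a.coeff x.2‖ := by
          gcongr; exact hg.derivative _
      _ < M := by simpa using hlt x.2 (by omega)
  have e1 : (e : L) * a.coeff (e + 1) = (derivative a * g - derivative g * a).coeff (e + 1)
      - ((derivative a * g).coeff (e + 1) - ((e : L) + 1) * a.coeff (e + 1))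
      + ((derivative g * a).coeff (e + 1) - a.coeff (e + 1)) := by
    rw [coeff_sub]; ring
  rw [e1]
  exact norm_add_lt_of_lt (norm_sub_lt_of_lt hcomm h1) h2

/-- Iterating a vector field `a ∂` which is of the form `a = cX^{e+1} + ⋯` with `e = 0` in the field
does not decrease the norm. -/
lemma leading_coeff_step {M τ A : ℝ} {a s s' : L[X]} {e k : ℕ} (hτ : τ < M) (hA : 0 < A)
    (he : (e : L) = 0) (ha : CoeffLE M a) (hd : ‖a.coeff (e + 1)‖ = M)
    (hlt : ∀ i < e + 1, ‖a.coeff i‖ < M) (hs : CoeffLE A s)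
    (hslt : ∀ n < 1 + k * e, ‖s.coeff n‖ < A) (hsd : ‖s.coeff (1 + k * e)‖ = A)
    (hs' : CoeffLE (τ * A) (s' - derivative s * a)) :
    CoeffLE (A * M) s' ∧ (∀ n < 1 + (k + 1) * e, ‖s'.coeff n‖ < A * M) ∧
      ‖s'.coeff (1 + (k + 1) * e)‖ = A * M := by
  have hM : 0 < M := (norm_nonneg _).trans_lt (hlt 0 (by omega))
  have hAM : 0 < A * M := mul_pos hA hM
  have hτA : τ * A < A * M := by nlinarith
  have e1 : s' = (s' - derivative s * a) + derivative s * a := by ring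
  have hsmall : ∀ i j, i < k * e ∨ j < e + 1 →
      ‖(derivative s).coeff i * a.coeff j‖ < A * M := fun i j hij => by
    have hnat : ‖(i : L) + 1‖ ≤ 1 := by exact_mod_cast norm_natCast_le_one' (L := L) (i + 1)
    rw [norm_mul, coeff_derivative, norm_mul]
    rcases hij with h | h
    · calc ‖s.coeff (i + 1)‖ * ‖(i : L) + 1‖ * ‖a.coeff j‖
          ≤ ‖s.coeff (i + 1)‖ * 1 * M := by gcongr; exact ha _
        _ < A * M := by rw [mul_one]; exact mul_lt_mul_of_pos_right (hslt _ (by omega)) hM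
    · calc ‖s.coeff (i + 1)‖ * ‖(i : L) + 1‖ * ‖a.coeff j‖
          ≤ A * 1 * ‖a.coeff j‖ := by gcongr; exact hs _
        _ < A * M := by rw [mul_one]; exact mul_lt_mul_of_pos_left (hlt _ h) hA
  refine ⟨?_, fun n hn => ?_, ?_⟩
  · rw [e1]
    exact (hs'.mono hτA.le).add (hs.derivative.mul ha)
  · rw [e1, coeff_add]
    refine norm_add_lt_of_lt ((hs' n).trans_lt hτA) ?_
    rw [coeff_mul]
    refine norm_sum_lt_of_lt hAM fun x hx => hsmall _ _ ?_
    have := HasAntidiagonal.mem_antidiagonal.1 hx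
    by_contra hc
    push Not at hc
    nlinarith
  · have hm : (k * e, e + 1) ∈ antidiagonal (1 + (k + 1) * e) := by
      rw [HasAntidiagonal.mem_antidiagonal]; ring
    have hmain : ‖(derivative s).coeff (k * e) * a.coeff (e + 1)‖ = A * M := by
      rw [coeff_derivative, Nat.cast_mul, he, mul_zero, zero_add, mul_one, add_comm, norm_mul, hsd,
        hd]
    rw [← hmain]
    apply norm_eq_of_norm_sub_lt
    rw [hmain, e1, coeff_add, coeff_mul, ← add_sum_erase _ _ hm]
    rw [add_sub_assoc, add_sub_cancel_left]
    refine norm_add_lt_of_lt ((hs' _).trans_lt hτA) ?_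
    refine norm_sum_lt_of_lt hAM fun x hx => hsmall _ _ ?_
    simp only [mem_erase, ne_eq, Prod.ext_iff, HasAntidiagonal.mem_antidiagonal] at hx
    by_contra hc
    push Not at hc
    obtain ⟨h1, h2⟩ := hx
    have h3 : x.1 + x.2 = k * e + (e + 1) := by rw [h2]; ring
    exact h1 ⟨by omega, by omega⟩

/-- If `f` has a Poincaré series, then all `q`-binomial operators of `f` are integral on a disc on
which `(f - X) / (λ - 1)` is integral. -/
theorem HasPoincareSeries.coeffLE_qBinom (p : ℕ) [Fact p.Prime] [CharP L p] (hP : HasPoincareSeries lam f)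
    (hroot : ∀ n : ℕ, 0 < n → lam ^ n ≠ 1) (hlam : ‖lam - 1‖ < 1) (hfg : f = X + (lam - 1) • g)
    (hg : CoeffLE 1 g) (hg0 : g.coeff 0 = 0) (hg1 : g.coeff 1 = 1) (m : ℕ) :
    CoeffLE 1 (qBinom f lam m X) := by
  induction m using Nat.strong_induction_on with
  | _ m hltm =>
  by_contra hbad
  have hm : 0 < m := Nat.pos_of_ne_zero fun h => hbad (by subst h; exact coeffLE_X)
  have hlam1 := norm_eq_one_of_norm_sub_one_lt hlam
  set E := lam - 1 with hE
  have hE0 : E ≠ 0 := by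
    have := hroot 1 one_pos
    rwa [pow_one, ← sub_ne_zero] at this
  have hfX : f - X = E • g := by rw [hfg]; ring
  have hδ : CoeffLE ‖E‖ (f - X) := by rw [hfX]; simpa using hg.smul E
  have hf : CoeffLE 1 f := by
    rw [hfg]; exact coeffLE_X.add ((hg.smul E).mono (by linarith))
  have hf0 : f.coeff 0 = 0 := by simp [hfg, hg0]
  obtain ⟨M, d, hM, ha, hd, hlt⟩ := exists_first_max_coeff hbad
  set a := qBinom f lam m X with ha_def
  obtain ⟨e, rfl⟩ : ∃ e, d = e + 1 := by
    refine Nat.exists_eq_succ_of_ne_zero fun h => ?_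
    rw [h, coeff_zero_qBinom hf0 m coeff_X_zero, norm_zero] at hd
    linarith
  set τ := max 1 (‖E‖ * M) with hτ
  have hτM : τ < M := max_lt hM (mul_lt_of_lt_one_left (by linarith) hlam)
  have hvf : ∀ {B : ℝ} {F : L[X]}, CoeffLE B F →
      CoeffLE (τ * B) (qBinom f lam m F - derivative F * a) := fun hF =>
    coeffLE_qBinom_sub hroot hf hδ hM.le hm hltm ha hF
  -- `A` commutes with the `q`-binomial. Comparing the Taylor expansion of `A a` with the image of
  -- `f = X + E g` and dividing by `E` puts the image of `g` near `a' g`; the vector field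
  -- approximation puts it near `g' a`. So the bracket of `a∂` and `g∂` has norm below `M`.
  have he : (e : L) = 0 := by
    have h1 : CoeffLE (‖E‖ * M) (qBinom f lam m g - derivative a * g) := by
      refine CoeffLE.of_smul hE0 ?_
      have h := hf.aeval_taylor hδ ha
      rw [mul_assoc] at h
      have e1 : aeval f a = a + E • qBinom f lam m g := by
        rw [ha_def, ← qBinom_aeval, aeval_X, ← map_smul, ← map_add, ← hfg]
      have e2 : aeval f a - a - derivative a * (f - X)
          = E • (qBinom f lam m g - derivative a * g) := by
        rw [e1, hfX, add_sub_cancel_left, smul_sub, mul_smul_comm]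
      rwa [e2] at h
    have h2 := (hvf hg).sub ((h1.mono (le_max_right _ _)).mono (mul_one τ).ge)
    have h3 := norm_index_mul_lt (e := e) (by linarith) hg hg0 hg1 hlt (by
      refine (le_of_eq_of_le ?_ (h2 (e + 1))).trans_lt ((mul_one τ).trans_lt hτM)
      congr 2; ring)
    by_contra hne
    have h4 : ¬ p ∣ e := fun h => hne ((CharP.cast_eq_zero_iff L p e).2 h)
    rw [norm_mul, norm_natCast_eq_one h4, one_mul, hd] at h3
    exact lt_irrefl _ h3
  have hπ : qRising lam 1 m ≠ 0 := qRising_one_ne_zero hroot m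
  -- Each block of `m` factors is divided by the `q`-factorial of order `m`, so one step of `s` is
  -- `a∂` up to an error of relative size `τ < M`.
  set s : ℕ → L[X] := fun N => (qRising lam 1 m ^ N)⁻¹ • shiftProd f lam 0 (N * m) X with hs
  have hsN : ∀ N, shiftProd f lam 0 (N * m) X = qRising lam 1 m ^ N • s N := fun N =>
    (smul_inv_smul₀ (pow_ne_zero _ hπ) _).symm
  have hstep : ∀ N {B : ℝ}, CoeffLE B (s N) →
      CoeffLE (τ * B) (s (N + 1) - derivative (s N) * a) := fun N B hB => by
    obtain ⟨β, hβ0, hβ, hβm⟩ := exists_shiftProd_eq (f := f) hroot hlam1 (N * m)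
    have e1 : s (N + 1) = ∑ x ∈ antidiagonal m, β x.2 • qBinom f lam x.1 (s N) := by
      simp only [hs]
      rw [add_mul, one_mul, shiftProd_add, zero_add, hβm, pow_succ, mul_inv, mul_smul,
        inv_smul_smul₀ hπ, smul_sum]
      refine sum_congr rfl fun x _ => ?_
      rw [map_smul, smul_comm]
    have hmem : (m, 0) ∈ antidiagonal m := by simp
    rw [e1, ← add_sum_erase _ _ hmem, hβ0, one_smul, add_sub_right_comm]
    refine (hvf hB).add ((coeffLE_sum hB.nonneg fun x hx => ?_).mono
      (le_mul_of_one_le_left hB.nonneg (le_max_left _ _)))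
    simp only [mem_erase, ne_eq, Prod.ext_iff, HasAntidiagonal.mem_antidiagonal] at hx
    have h := CoeffLE.map (fun n =>
      (coeffLE_qBinom_X_pow hroot hf hM.le hm hltm ha n).1 x.1 (by omega)) hB
    rw [one_mul] at h
    exact (h.smul (β x.2)).mono (mul_le_of_le_one_left hB.nonneg (hβ _))
  have hind : ∀ N, CoeffLE (M ^ N) (s N) ∧ (∀ n < 1 + N * e, ‖(s N).coeff n‖ < M ^ N) ∧
      ‖(s N).coeff (1 + N * e)‖ = M ^ N := fun N => by
    induction N with
    | zero =>
      have e0 : s 0 = X := by simp [hs, shiftProd]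
      rw [e0]
      refine ⟨by simpa using coeffLE_X, fun n hn => ?_, by simp⟩
      have : n = 0 := by omega
      simp [this]
    | succ N ih =>
      rw [pow_succ]
      exact leading_coeff_step hτM (by positivity) he ha hd hlt ih.1 ih.2.1 ih.2.2
        (hstep N ih.1)
  refine hP.not_pow_le (p := p) hlam hm (F := X) (e₀ := 1) (e₁ := e)
    (norm_pos_iff.2 hπ) fun N => ?_
  rw [hsN, coeff_smul, norm_smul, (hind N).2.2, norm_pow]
  exact le_mul_of_one_le_right (by positivity) (one_le_pow₀ hM.le)

end Integrality

/-! ### Multipliers of fixed points. -/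

section FixedPoints

variable {L : Type*} [NormedField L] {f : L[X]} {lam : L}

/-- The `q`-binomials of `f` act on the cotangent space of a fixed point of multiplier `μ` by the
`q`-binomials of `μ`. -/
lemma eval_derivative_qBinom (hroot : ∀ n : ℕ, 0 < n → lam ^ n ≠ 1) {x : L} (hx : f.eval x = x)
    (m : ℕ) : (derivative (qBinom f lam m X)).eval x
      = qFalling lam m ((derivative f).eval x) / qRising lam 1 m := by
  induction m with
  | zero => simp [qFalling, qRising]
  | succ m ih =>
    rw [qBinom_succ, ← comp_eq_aeval, derivative_smul, derivative_sub, derivative_comp,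
      derivative_smul, eval_smul, eval_sub, eval_mul, eval_comp, hx, eval_smul, ih,
      qFalling_succ, qRising_succ, smul_eq_mul, smul_eq_mul, add_comm 1 m]
    have h1 := qRising_one_ne_zero hroot m
    have h2 : lam ^ (m + 1) - 1 ≠ 0 := sub_ne_zero.2 (hroot _ m.succ_pos)
    field_simp

/-- The value at `c` is the product of the differences `c - t` over the roots, so one difference
must be small. -/
lemma exists_root_norm_sub_lt [IsAlgClosed L] {q : L[X]} (hq : q.Monic) {c : L}
    (hc : ‖q.eval c‖ < 1) : ∃ t, q.eval t = 0 ∧ ‖c - t‖ < 1 := by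
  by_contra! h
  refine absurd hc (not_lt.2 ?_)
  rw [(IsAlgClosed.splits q).eval_eq_prod_roots_of_monic hq c]
  have hs : ∀ s : Multiset L, (∀ t ∈ s, 1 ≤ ‖c - t‖) → 1 ≤ ‖(s.map fun a => c - a).prod‖ := by
    intro s
    induction s using Multiset.induction_on with
    | empty => simp
    | cons a s ih =>
      intro hs
      rw [Multiset.map_cons, Multiset.prod_cons, norm_mul]
      exact one_le_mul_of_one_le_of_one_le (hs a (by simp))
        (ih fun t ht => hs t (Multiset.mem_cons_of_mem ht))
  exact hs _ fun t ht => h t (isRoot_of_mem_roots ht)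

variable [IsUltrametricDist L]

/-- A number at which all `q`-binomial coefficients are integral is close to a power of `lam`. -/
lemma exists_norm_sub_pow_le (hroot : ∀ n : ℕ, 0 < n → lam ^ n ≠ 1) (hlam : ‖lam‖ = 1) {μ : L}
    {m : ℕ} (hm : 0 < m) (h : ‖qFalling lam m μ‖ ≤ ‖qRising lam 1 m‖) :
    ∃ i < m, ‖μ - lam ^ i‖ ≤ ‖lam ^ m - 1‖ := by
  obtain ⟨i, hi, hmin⟩ := exists_min_image (range m) (fun i => ‖μ - lam ^ i‖) ⟨0, by simpa using hm⟩
  rw [mem_range] at hi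
  refine ⟨i, hi, ?_⟩
  -- As `lam ^ i` is a nearest power to `μ`, the other factors of the falling product are at least
  -- `|λʲ - λⁱ|`. These multiply to two shorter `q`-factorials, leaving the bound on the factor `μ -
  -- lam ^ i`.
  have hdist : ∀ j < m, ‖lam ^ j - lam ^ i‖ ≤ ‖μ - lam ^ j‖ := fun j hj => by
    rw [← sub_sub_sub_cancel_left _ _ μ]
    exact norm_sub_le_of_le (hmin j (mem_range.2 hj)) le_rfl
  obtain ⟨b, rfl⟩ := Nat.exists_eq_add_of_lt hi
  have h1 : ‖qRising lam 1 i‖ ≤ ‖∏ j ∈ range i, (μ - lam ^ j)‖ := by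
    rw [qRising, norm_prod, norm_prod, ← prod_range_reflect]
    refine prod_le_prod (fun _ _ => norm_nonneg _) fun j hj => ?_
    have hj := mem_range.1 hj
    refine (le_of_eq ?_).trans (hdist j (by omega))
    have : lam ^ j - lam ^ i = -(lam ^ j * (lam ^ (1 + (i - 1 - j)) - 1)) := by
      rw [mul_sub, ← pow_add, show j + (1 + (i - 1 - j)) = i by omega]; ring
    rw [this, norm_neg, norm_mul, norm_pow, hlam, one_pow, one_mul]
  have h2 : ‖qRising lam 1 b‖ ≤ ‖∏ j ∈ range b, (μ - lam ^ (i + 1 + j))‖ := by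
    rw [qRising, norm_prod, norm_prod]
    refine prod_le_prod (fun _ _ => norm_nonneg _) fun j hj => ?_
    have hj := mem_range.1 hj
    refine (le_of_eq ?_).trans (hdist (i + 1 + j) (by omega))
    have : lam ^ (i + 1 + j) - lam ^ i = lam ^ i * (lam ^ (1 + j) - 1) := by ring
    rw [this, norm_mul, norm_pow, hlam, one_pow, one_mul]
  have h3 : qFalling lam (i + b + 1) μ = (∏ j ∈ range i, (μ - lam ^ j)) * (μ - lam ^ i)
      * ∏ j ∈ range b, (μ - lam ^ (i + 1 + j)) := by
    rw [qFalling, show i + b + 1 = (i + 1) + b by ring, prod_range_add, prod_range_succ]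
  have h4 : 0 < ‖qRising lam 1 i‖ := norm_pos_iff.2 (qRising_one_ne_zero hroot i)
  have h5 : 0 < ‖qRising lam 1 b‖ := norm_pos_iff.2 (qRising_one_ne_zero hroot b)
  have h6 : ‖qRising lam 1 i‖ * ‖qRising lam 1 b‖ * ‖μ - lam ^ i‖
      ≤ ‖qRising lam 1 i‖ * ‖qRising lam 1 b‖ * ‖lam ^ (i + b + 1) - 1‖ := by
    calc _ = ‖qRising lam 1 i‖ * ‖μ - lam ^ i‖ * ‖qRising lam 1 b‖ := by ring
      _ ≤ ‖qFalling lam (i + b + 1) μ‖ := by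
          rw [h3, norm_mul, norm_mul]
          gcongr
      _ ≤ ‖qRising lam 1 (i + b + 1)‖ := h
      _ = ‖qRising lam 1 (i + b)‖ * ‖lam ^ (i + b + 1) - 1‖ := by
          rw [qRising_succ, norm_mul, add_comm 1 (i + b)]
      _ ≤ _ := mul_le_mul_of_nonneg_right (norm_qRising_one_add_le hlam i b) (norm_nonneg _)
  exact le_of_mul_le_mul_left h6 (mul_pos h4 h5)

/-- The multipliers of fixed points in the disc of integrality are close to powers of `lam`. -/
lemma exists_norm_multiplier_sub_le (hroot : ∀ n : ℕ, 0 < n → lam ^ n ≠ 1) (hlam : ‖lam‖ = 1)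
    (hint : ∀ m, CoeffLE 1 (qBinom f lam m X)) {x : L} (hx1 : ‖x‖ ≤ 1) (hx : f.eval x = x)
    {m : ℕ} (hm : 0 < m) : ∃ i < m, ‖(derivative f).eval x - lam ^ i‖ ≤ ‖lam ^ m - 1‖ := by
  refine exists_norm_sub_pow_le hroot hlam hm ?_
  have h := (hint m).derivative.norm_eval_le hx1
  rw [eval_derivative_qBinom hroot hx, norm_div] at h
  exact (div_le_one (norm_pos_iff.2 (qRising_one_ne_zero hroot m))).1 h

end FixedPoints

/-! ### Conjugation by homotheties. -/

section Scaling

variable {L : Type*} [NormedField L]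

/-- The polynomial `lam X + b X² + a Xᵖ`. -/
noncomputable def trinomial (p : ℕ) (lam b a : L) : L[X] := C lam * X + C b * X ^ 2 + C a * X ^ p

/-- Conjugating `f` by `z ↦ ρz` replaces `ψ(z)` by `ρ⁻¹ψ(ρz)`. -/
lemma HasPoincareSeries.scale {p : ℕ} (hp : 0 < p) {lam b a : L}
    (h : HasPoincareSeries lam (trinomial p lam b a)) {ρ : L} (hρ : ρ ≠ 0) :
    HasPoincareSeries lam (trinomial p lam (b * ρ) (a * ρ ^ (p - 1))) := by
  obtain ⟨ψ, h0, h1, ⟨r, hr, hψ⟩, hf⟩ := h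
  refine ⟨ρ⁻¹ • PowerSeries.rescale ρ ψ, ?_, ?_, ⟨‖ρ‖ * r, by positivity, fun n => ?_⟩, ?_⟩
  · simp [PowerSeries.coeff_rescale, h0]
  · simp [PowerSeries.coeff_rescale, h1, hρ]
  · rw [map_smul, PowerSeries.coeff_rescale, norm_smul, norm_mul, norm_inv, norm_pow, pow_succ',
      mul_assoc, inv_mul_cancel_left₀ (norm_ne_zero_iff.2 hρ), mul_pow]
    exact mul_le_mul_of_nonneg_left (hψ n) (by positivity)
  · have h2 := congrArg (fun φ => ρ⁻¹ • PowerSeries.rescale ρ φ) hf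
    obtain ⟨k, rfl⟩ : ∃ k, p = k + 1 := ⟨p - 1, by omega⟩
    have h3 : ρ⁻¹ • PowerSeries.rescale ρ (PowerSeries.rescale lam ψ)
        = PowerSeries.rescale lam (ρ⁻¹ • PowerSeries.rescale ρ ψ) := by
      ext n
      simp only [map_smul, PowerSeries.coeff_rescale, smul_eq_mul]
      ring
    rw [← h3]
    refine Eq.trans ?_ h2
    simp only [trinomial, ← smul_eq_C_mul, map_add, map_smul, map_pow, aeval_X,
      Nat.add_sub_cancel]
    have h4 : ∀ c : L, ∀ φ : PowerSeries L,
        PowerSeries.rescale ρ (c • φ) = c • PowerSeries.rescale ρ φ := fun c φ => by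
      ext n
      simp only [map_smul, PowerSeries.coeff_rescale, smul_eq_mul]
      ring
    simp only [map_pow, h4, smul_add, _root_.smul_pow, smul_smul]
    congr 1
    · congr 1
      · rw [mul_comm]
      · congr 1; field_simp
    · congr 1; rw [inv_pow, pow_succ]; field_simp

end Scaling

/-! ### Small β: the fixed point near -1. -/

section Trinomials

variable {L : Type*} [NormedField L] {p : ℕ} [Fact p.Prime] [CharP L p]

lemma norm_two_eq_one (hp : 2 < p) : ‖(2 : L)‖ = 1 := by
  exact_mod_cast norm_natCast_eq_one (p := p) (L := L) (n := 2)
    fun h => absurd (Nat.le_of_dvd two_pos h) (by omega)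

lemma norm_pow_prime_sub_one (x : L) : ‖x ^ p - 1‖ = ‖x - 1‖ ^ p := by
  simpa using congrArg norm (pow_prime_pow_sub_one (p := p) x 1)

variable [IsUltrametricDist L] {lam : L}

lemma HasPoincareSeries.exists_norm_fixedPoint_sub_le {η γ : L}
    (hP : HasPoincareSeries lam (trinomial p lam ((lam - 1) * η) ((lam - 1) * γ))) (hp : 2 < p)
    (hroot : ∀ n : ℕ, 0 < n → lam ^ n ≠ 1) (hlam : ‖lam - 1‖ < 1) (hη : ‖η‖ ≤ 1) (hγ : ‖γ‖ ≤ 1)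
    {x : L} (hx1 : ‖x‖ ≤ 1) (hx : 1 + η * x + γ * x ^ (p - 1) = 0) {m : ℕ} (hm : 0 < m) :
    ∃ i < m, ‖lam + 2 * ((lam - 1) * η * x) - lam ^ i‖ ≤ ‖lam ^ m - 1‖ := by
  set g : L[X] := X + C η * X ^ 2 + C γ * X ^ p with hgdef
  have hfg : trinomial p lam ((lam - 1) * η) ((lam - 1) * γ) = X + (lam - 1) • g := by
    rw [trinomial, hgdef, smul_eq_C_mul]
    simp only [C_mul, C_sub, C_1]
    ring
  have hg : CoeffLE 1 g := by
    refine (coeffLE_X.add ?_).add ?_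
    · exact ((coeffLE_C η).mul_one (coeffLE_X_pow 2)).mono hη
    · exact ((coeffLE_C γ).mul_one (coeffLE_X_pow p)).mono hγ
  have hg0 : g.coeff 0 = 0 := by
    rw [coeff_zero_eq_eval_zero, hgdef]
    simp [show p ≠ 0 by omega]
  have hg1 : g.coeff 1 = 1 := by
    simp [hgdef, coeff_X_pow, show (1 : ℕ) ≠ p by omega]
  have hint := hP.coeffLE_qBinom p hroot hlam hfg hg hg0 hg1
  have hgx : g.eval x = 0 := by
    have h : g.eval x = x * (1 + η * x + γ * x ^ (p - 1)) := by
      obtain ⟨k, rfl⟩ : ∃ k, p = k + 1 := ⟨p - 1, by omega⟩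
      simp only [hgdef, eval_add, eval_mul, eval_X, eval_C, eval_pow, Nat.add_sub_cancel]
      ring
    rw [h, hx, mul_zero]
  have hfx : (trinomial p lam ((lam - 1) * η) ((lam - 1) * γ)).eval x = x := by
    rw [hfg, eval_add, eval_smul, hgx, smul_zero, add_zero, eval_X]
  have hder : (derivative (trinomial p lam ((lam - 1) * η) ((lam - 1) * γ))).eval x
      = lam + 2 * ((lam - 1) * η * x) := by
    simp only [trinomial, derivative_add, derivative_C_mul, derivative_X_pow, derivative_X,
      CharP.cast_eq_zero, C_0, zero_mul, mul_zero, add_zero]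
    simp
    ring
  have h := exists_norm_multiplier_sub_le hroot (norm_eq_one_of_norm_sub_one_lt hlam) hint hx1 hfx hm
  rwa [hder] at h

/-- The fixed point near `-1` has multiplier so close to `λ⁻¹` that it can only match `λᵖ⁻¹` among
the first `p` powers; equality of the second-order terms would require `|β| = |λ - 1|`. -/
lemma not_hasPoincareSeries_of_norm_lt_one [IsAlgClosed L] (hp : 2 < p)
    (hroot : ∀ n : ℕ, 0 < n → lam ^ n ≠ 1) (hlam : ‖lam - 1‖ < 1) {β : L} (hβ : ‖β‖ < 1)
    (hβE : ‖β‖ ≠ ‖lam - 1‖) :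
    ¬ HasPoincareSeries lam (trinomial p lam (lam - 1) ((lam - 1) * β)) := by
  intro hP
  have hlam1 := norm_eq_one_of_norm_sub_one_lt hlam
  have hE0 : 0 < ‖lam - 1‖ := norm_pos_iff.2 (sub_ne_zero.2 (by simpa using hroot 1 one_pos))
  have hprime : p.Prime := Fact.out
  have hodd : Odd p := hprime.odd_of_ne_two (by omega)
  obtain ⟨k, hk⟩ : ∃ k, p = 2 * k + 3 := by
    obtain ⟨r, hr⟩ := hodd; exact ⟨r - 1, by omega⟩
  have hmonic : (X ^ (p - 1) + X ^ (p - 2) + C β : L[X]).Monic := by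
    rw [add_assoc]
    refine monic_X_pow_add (lt_of_le_of_lt (degree_add_le _ _) (max_lt ?_ ?_))
    · rw [degree_X_pow]; exact_mod_cast (by omega : p - 2 < p - 1)
    · exact degree_C_le.trans_lt (by exact_mod_cast (by omega : 0 < p - 1))
  have heval : (X ^ (p - 1) + X ^ (p - 2) + C β : L[X]).eval (-1) = β := by
    have e1 : Even (p - 1) := ⟨k + 1, by omega⟩
    have e2 : Odd (p - 2) := ⟨k, by omega⟩
    simp [e1.neg_one_pow, e2.neg_one_pow]
  obtain ⟨t, ht, htn⟩ := exists_root_norm_sub_lt hmonic (c := -1) (by rwa [heval])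
  have ht1 : ‖t‖ = 1 := by
    have h : ‖t - (-1)‖ < ‖(-1 : L)‖ := by rwa [norm_sub_rev, norm_neg, norm_one]
    simpa using norm_eq_of_norm_sub_lt h
  have ht0 : t ≠ 0 := norm_ne_zero_iff.1 (by rw [ht1]; exact one_ne_zero)
  simp only [eval_add, eval_pow, eval_X, eval_C] at ht
  have hx : 1 + 1 * t⁻¹ + β * t⁻¹ ^ (p - 1) = 0 := by
    have h1 : t ^ (p - 1) = t ^ (p - 2) * t := by rw [← pow_succ]; congr 1; omega
    have h2 : 1 + 1 * t⁻¹ + β * t⁻¹ ^ (p - 1)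
        = (t ^ (p - 1) + t ^ (p - 2) + β) * t⁻¹ ^ (p - 1) := by
      rw [inv_pow, h1]; field_simp
    rw [h2, ht, zero_mul]
  have hxn : ‖t⁻¹‖ = 1 := by rw [norm_inv, ht1, inv_one]
  have h1x : ‖1 + t⁻¹‖ = ‖β‖ := by
    rw [show 1 + t⁻¹ = -(β * t⁻¹ ^ (p - 1)) by linear_combination hx, norm_neg, norm_mul, norm_pow,
      hxn, one_pow, _root_.mul_one]
  generalize t⁻¹ = x at hx hxn h1x
  have hP' : HasPoincareSeries lam (trinomial p lam ((lam - 1) * 1) ((lam - 1) * β)) := by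
    rwa [_root_.mul_one]
  obtain ⟨i, hi, hle⟩ := hP'.exists_norm_fixedPoint_sub_le hp hroot hlam norm_one.le hβ.le hxn.le hx
    (show 0 < p by omega)
  rw [norm_pow_prime_sub_one] at hle
  set E := lam - 1 with hE
  -- Multiply by the unit `lam` and use `lam * (lam - 2 * E) = 1 - E ^ 2`.
  have hle' : ‖(-E ^ 2 + 2 * E * lam * (1 + x)) - (lam ^ (i + 1) - 1)‖ ≤ ‖E‖ ^ p := by
    refine le_of_eq_of_le ?_ hle
    rw [← _root_.one_mul ‖lam + _ - _‖, ← hlam1, ← norm_mul]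
    congr 1
    rw [hE]; ring
  have hEp : ‖E‖ ^ p < ‖E‖ ^ 2 := pow_lt_pow_right_of_lt_one₀ hE0 hlam hp
  have hE2 : ‖E‖ ^ 2 < ‖E‖ := by nlinarith
  have h2 : ‖2 * lam * (1 + x)‖ = ‖β‖ := by
    rw [norm_mul, norm_mul, norm_two_eq_one (p := p) hp, hlam1, h1x]; ring
  have hdvd : p ∣ i + 1 := by
    by_contra h
    have h3 := norm_pow_sub_one_of_not_dvd hlam h
    have h4 : ‖-E ^ 2 + 2 * E * lam * (1 + x)‖ < ‖E‖ := by
      refine norm_add_lt_of_lt (by rwa [norm_neg, norm_pow]) ?_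
      rw [show 2 * E * lam * (1 + x) = E * (2 * lam * (1 + x)) by ring, norm_mul, h2]
      nlinarith
    have h5 := norm_sub_lt_of_lt h4 (hle'.trans_lt (hEp.trans hE2))
    rw [sub_sub_cancel, h3] at h5
    exact lt_irrefl _ h5
  have hip : i + 1 = p := le_antisymm hi (Nat.le_of_dvd i.succ_pos hdvd)
  rw [hip] at hle'
  have h3 : ‖-E ^ 2 + 2 * E * lam * (1 + x)‖ ≤ ‖E‖ ^ p := by
    have := norm_add_le_of_le hle' (norm_pow_prime_sub_one (p := p) lam).le
    rwa [sub_add_cancel] at this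
  have h4 : ‖E‖ * ‖2 * lam * (1 + x) - E‖ < ‖E‖ * ‖E‖ := by
    rw [← norm_mul, ← sq]
    refine (le_of_eq_of_le ?_ h3).trans_lt hEp
    congr 1; ring
  exact hβE (h2 ▸ norm_eq_of_norm_sub_lt (lt_of_mul_lt_mul_left h4 hE0.le))

end Trinomials

/-! ### Large β: comparing several fixed points. -/

section ResonantTrinomials

variable {L : Type*} [NormedField L]

lemma monic_X_pow_sub_linear {n : ℕ} (hn : 1 < n) (η : L) : (X ^ n - C η * X - 1 : L[X]).Monic := by
  rw [sub_sub]
  refine monic_X_pow_sub (lt_of_le_of_lt (degree_add_le _ _) (max_lt ?_ ?_))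
  · exact (degree_C_mul_X_le η).trans_lt (by exact_mod_cast hn)
  · exact degree_one_le.trans_lt (by exact_mod_cast (by omega : 0 < n))

variable [IsUltrametricDist L]

lemma norm_pow_sub_pow_le {x y : L} (hx : ‖x‖ ≤ 1) (hy : ‖y‖ ≤ 1) (n : ℕ) :
    ‖x ^ n - y ^ n‖ ≤ ‖x - y‖ := by
  induction n with
  | zero => simp
  | succ n ih =>
    rw [show x ^ (n + 1) - y ^ (n + 1) = x * (x ^ n - y ^ n) + (x - y) * y ^ n by ring]
    refine norm_add_le_of_le ?_ ?_
    · rw [norm_mul]; exact (mul_le_of_le_one_left (norm_nonneg _) hx).trans ih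
    · rw [norm_mul, norm_pow]
      exact mul_le_of_le_one_right (norm_nonneg _) (pow_le_one₀ (norm_nonneg _) hy)

lemma norm_eq_one_of_pow_eq {n : ℕ} (hn : 1 < n) {η x : L} (hη : ‖η‖ ≤ 1)
    (hx : x ^ n = 1 + η * x) : ‖x‖ = 1 := by
  obtain ⟨k, rfl⟩ : ∃ k, n = k + 2 := ⟨n - 2, by omega⟩
  refine le_antisymm ?_ ?_
  · by_contra! h
    have h1 : ‖x ^ (k + 2)‖ ≤ ‖x‖ := by
      rw [hx]
      refine norm_add_le_of_le (by rw [norm_one]; exact h.le) ?_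
      rw [norm_mul]; exact mul_le_of_le_one_left (norm_nonneg _) hη
    rw [norm_pow] at h1
    exact absurd h1 (not_le.2 (lt_self_pow₀ h (by omega)))
  · by_contra! h
    have h1 : ‖(1 : L)‖ ≤ ‖x‖ := by
      rw [show (1 : L) = x ^ (k + 2) - η * x by rw [hx]; ring]
      refine norm_sub_le_of_le ?_ ?_
      · rw [norm_pow]; exact pow_le_of_le_one (norm_nonneg _) h.le (by omega)
      · rw [norm_mul]; exact mul_le_of_le_one_left (norm_nonneg _) hη
    rw [norm_one] at h1
    exact absurd h1 (not_le.2 h)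

variable {p : ℕ} [Fact p.Prime] [CharP L p] {lam : L}

/-- The pairs of fixed points near `1` and `-1` have incompatible multipliers. -/
lemma not_hasPoincareSeries_resonant_of_norm_lt_one [IsAlgClosed L] (hp : 2 < p)
    (hroot : ∀ n : ℕ, 0 < n → lam ^ n ≠ 1) (hlam : ‖lam - 1‖ < 1) {η : L} (hη0 : η ≠ 0)
    (hη : ‖η‖ < 1) :
    ¬ HasPoincareSeries lam (trinomial p lam ((lam - 1) * η) ((lam - 1) * (-1))) := by
  intro hP
  have hlam1 := norm_eq_one_of_norm_sub_one_lt hlam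
  have hE0 : 0 < ‖lam - 1‖ := norm_pos_iff.2 (sub_ne_zero.2 (by simpa using hroot 1 one_pos))
  have hprime : p.Prime := Fact.out
  have he : Even (p - 1) := hprime.even_sub_one (by omega)
  have h2 : ‖(2 : L)‖ = 1 := norm_two_eq_one hp
  have hmonic := monic_X_pow_sub_linear (show 1 < p - 1 by omega) η
  obtain ⟨x₁, hx₁, hd₁⟩ := exists_root_norm_sub_lt hmonic (c := 1) (by simpa using hη)
  obtain ⟨x₂, hx₂, hd₂⟩ := exists_root_norm_sub_lt hmonic (c := -1)
    (by simpa [he.neg_one_pow] using hη)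
  simp only [eval_sub, eval_pow, eval_X, eval_mul, eval_C, eval_one] at hx₁ hx₂
  have hn₁ : ‖x₁‖ = 1 :=
    norm_eq_one_of_pow_eq (show 1 < p - 1 by omega) hη.le (by linear_combination hx₁)
  have hn₂ : ‖x₂‖ = 1 :=
    norm_eq_one_of_pow_eq (show 1 < p - 1 by omega) hη.le (by linear_combination hx₂)
  have hadd : ‖x₁ + x₂‖ < 1 := by
    rw [show x₁ + x₂ = -((1 - x₁) + (-1 - x₂)) by ring, norm_neg]
    exact norm_add_lt_of_lt hd₁ hd₂
  set ζ := (lam - 1) * η with hζ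
  have hζ0 : 0 < ‖ζ‖ := by rw [hζ, norm_mul]; exact mul_pos hE0 (norm_pos_iff.2 hη0)
  have hζη : ‖ζ‖ < ‖η‖ := by
    rw [hζ, norm_mul]; exact mul_lt_of_lt_one_left (norm_pos_iff.2 hη0) hlam
  have hζ1 : ‖ζ‖ < 1 := hζη.trans hη
  have hζ2 : ‖ζ‖ ^ 2 < ‖ζ‖ := by nlinarith
  -- Matching powers of `lam` up to order `p ^ N` gives precision finer than `|ζ|²`.
  obtain ⟨N, hN⟩ := exists_pow_lt_of_lt_one (pow_pos hζ0 2) hlam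
  have hm : ‖lam ^ p ^ N - 1‖ < ‖ζ‖ ^ 2 := by
    rw [pow_prime_pow_sub_one, norm_pow]
    exact (pow_le_pow_of_le_one hE0.le hlam.le (Nat.lt_pow_self hprime.one_lt).le).trans_lt hN
  have hm0 : 0 < p ^ N := pow_pos hprime.pos N
  have key : ∀ x : L, ‖x‖ = 1 → x ^ (p - 1) - η * x - 1 = 0 →
      ∃ a, ‖lam + 2 * (ζ * x) - lam * lam ^ a‖ < ‖ζ‖ ^ 2 ∧ ‖lam ^ a - 1‖ = ‖ζ‖ := by
    intro x hxn hx
    obtain ⟨i, -, hi⟩ := hP.exists_norm_fixedPoint_sub_le hp hroot hlam hη.le (by simp) hxn.le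
      (by linear_combination -hx) hm0
    -- This is `i - 1`, shifted by `p ^ N` to remain a natural number when `i = 0`; the shift
    -- changes the power by less than the chosen precision.
    refine ⟨i + p ^ N - 1, ?_⟩
    have h1 : ‖lam + 2 * (ζ * x) - lam * lam ^ (i + p ^ N - 1)‖ < ‖ζ‖ ^ 2 := by
      rw [← pow_succ', Nat.sub_add_cancel (by omega), pow_add,
        show lam + 2 * (ζ * x) - lam ^ i * lam ^ p ^ N
          = (lam + 2 * (ζ * x) - lam ^ i) - lam ^ i * (lam ^ p ^ N - 1) by ring]
      refine norm_sub_lt_of_lt (hi.trans_lt hm) ?_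
      rwa [norm_mul, norm_pow, hlam1, one_pow, _root_.one_mul]
    refine ⟨h1, ?_⟩
    have h3 : ‖2 * (ζ * x)‖ = ‖ζ‖ := by rw [norm_mul, norm_mul, h2, hxn]; ring
    rw [← h3, ← _root_.one_mul ‖lam ^ _ - 1‖, ← hlam1, ← norm_mul]
    refine norm_eq_of_norm_sub_lt ?_
    rw [h3, norm_sub_rev]
    refine (le_of_eq ?_).trans_lt (h1.trans hζ2)
    congr 1; ring
  obtain ⟨a, ha, ha'⟩ := key x₁ hn₁ hx₁
  obtain ⟨b, hb, hb'⟩ := key x₂ hn₂ hx₂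
  have ha0 : a ≠ 0 := by
    rintro rfl
    rw [pow_zero, sub_self, norm_zero] at ha'
    exact hζ0.ne ha'
  have hprod : ‖lam ^ 2 * (lam ^ (a + b) - 1)
      - (2 * lam * ζ * (x₁ + x₂) + 4 * ζ ^ 2 * (x₁ * x₂))‖ < ‖ζ‖ ^ 2 := by
    rw [show lam ^ 2 * (lam ^ (a + b) - 1) - (2 * lam * ζ * (x₁ + x₂) + 4 * ζ ^ 2 * (x₁ * x₂))
      = -((lam * lam ^ a) * (lam + 2 * (ζ * x₂) - lam * lam ^ b)
        + (lam + 2 * (ζ * x₁) - lam * lam ^ a) * (lam + 2 * (ζ * x₂))) by ring, norm_neg]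
    refine norm_add_lt_of_lt ?_ ?_
    · rwa [norm_mul, norm_mul, norm_pow, hlam1, one_pow, _root_.one_mul, _root_.one_mul]
    · rw [norm_mul]
      refine (mul_le_of_le_one_right (norm_nonneg _) (norm_add_le_of_le hlam1.le ?_)).trans_lt ha
      rw [norm_mul, norm_mul, h2, hn₂]; simpa using hζ1.le
  have h4 : ‖4 * ζ ^ 2 * (x₁ * x₂)‖ = ‖ζ‖ ^ 2 := by
    rw [show (4 : L) = 2 * 2 by norm_num]
    simp only [norm_mul, norm_pow, h2, hn₁, hn₂]; ring
  have h5 : ‖2 * lam * ζ * (x₁ + x₂)‖ = ‖ζ‖ * ‖x₁ + x₂‖ := by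
    simp only [norm_mul, h2, hlam1]; ring
  have h6 : ‖lam ^ (a + b) - 1‖ < ‖ζ‖ := by
    have h : ‖lam ^ 2 * (lam ^ (a + b) - 1)‖ < ‖ζ‖ := by
      rw [← sub_add_cancel (lam ^ 2 * (lam ^ (a + b) - 1))
        (2 * lam * ζ * (x₁ + x₂) + 4 * ζ ^ 2 * (x₁ * x₂))]
      refine norm_add_lt_of_lt (hprod.trans hζ2) (norm_add_lt_of_lt ?_ (h4.trans_lt hζ2))
      rw [h5]; exact mul_lt_of_lt_one_right hζ0 hadd
    rwa [norm_mul, norm_pow, hlam1, one_pow, _root_.one_mul] at h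
  -- The norms `|λⁿ - 1|` take only the values `|λ - 1|^(pᵏ)`, for `n > 0`. Being smaller than the
  -- value `|ζ|` therefore means being at most `|ζ|ᵖ`.
  have h7 : ‖lam ^ (a + b) - 1‖ < ‖ζ‖ ^ 2 := by
    obtain ⟨s, hs⟩ := exists_norm_pow_sub_one (p := p) hlam ha0
    obtain ⟨t, ht⟩ := exists_norm_pow_sub_one (p := p) hlam (show a + b ≠ 0 by omega)
    rw [ha'] at hs
    rw [ht, hs] at h6
    have hst : p ^ s < p ^ t := (pow_lt_pow_iff_right_of_lt_one₀ hE0 hlam).1 h6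
    have hst' : s + 1 ≤ t := (Nat.pow_lt_pow_iff_right hprime.one_lt).1 hst
    calc ‖lam ^ (a + b) - 1‖ = ‖lam - 1‖ ^ p ^ t := ht
      _ ≤ ‖lam - 1‖ ^ p ^ (s + 1) :=
          pow_le_pow_of_le_one hE0.le hlam.le (Nat.pow_le_pow_right hprime.pos hst')
      _ = ‖ζ‖ ^ p := by rw [hs, ← pow_mul, pow_succ]
      _ < ‖ζ‖ ^ 2 := pow_lt_pow_right_of_lt_one₀ hζ0 hζ1 hp
  have h8 : ‖2 * lam * ζ * (x₁ + x₂)‖ = ‖ζ‖ ^ 2 := by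
    rw [← h4, ← norm_neg (4 * ζ ^ 2 * (x₁ * x₂))]
    refine norm_eq_of_norm_sub_lt ?_
    rw [norm_neg, h4, sub_neg_eq_add]
    have h : ‖lam ^ 2 * (lam ^ (a + b) - 1)‖ < ‖ζ‖ ^ 2 := by
      rwa [norm_mul, norm_pow, hlam1, one_pow, _root_.one_mul]
    have := norm_sub_lt_of_lt h hprod
    rwa [sub_sub_cancel] at this
  have h9 : ‖x₁ + x₂‖ = ‖ζ‖ := by
    rw [h5, sq] at h8
    exact mul_left_cancel₀ hζ0.ne' h8
  have h10 : ‖x₁ - x₂‖ = 1 := by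
    have h3 : ‖2 * x₁‖ = 1 := by rw [norm_mul, h2, hn₁, _root_.one_mul]
    rw [← h3]
    refine norm_eq_of_norm_sub_lt ?_
    rwa [h3, show x₁ - x₂ - 2 * x₁ = -(x₁ + x₂) by ring, norm_neg]
  -- Since `p - 1` is even, `x₁` and `-x₂` have powers differing by `η (x₁ - x₂)`, of norm `|η|`,
  -- although the points themselves are only `|ζ| < |η|` apart.
  have h11 := norm_pow_sub_pow_le (y := -x₂) hn₁.le (by rw [norm_neg, hn₂]) (p - 1)
  rw [he.neg_pow, sub_neg_eq_add, h9,
    show x₁ ^ (p - 1) - x₂ ^ (p - 1) = η * (x₁ - x₂) by linear_combination hx₁ - hx₂, norm_mul, h10,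
    _root_.mul_one] at h11
  exact absurd h11 (not_le.2 hζη)

lemma norm_pow_sub_one_sub_natCast_mul_le (hlam : ‖lam - 1‖ ≤ 1) (i : ℕ) :
    ‖lam ^ i - 1 - i * (lam - 1)‖ ≤ ‖lam - 1‖ ^ 2 := by
  have hlam1 : ‖lam‖ ≤ 1 := by
    simpa using norm_add_le_of_le hlam (norm_one (α := L)).le
  induction i with
  | zero => simp
  | succ i ih =>
    rw [show lam ^ (i + 1) - 1 - (i + 1 : ℕ) * (lam - 1)
      = (lam ^ i - 1 - i * (lam - 1)) + (lam ^ i - 1) * (lam - 1) by push_cast; ring]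
    refine norm_add_le_of_le ih ?_
    rw [norm_mul, sq]
    refine mul_le_mul_of_nonneg_right ?_ (norm_nonneg _)
    simpa using norm_pow_sub_pow_le hlam1 (norm_one (α := L)).le i

/-- The multipliers force all nonzero fixed points to be congruent, but they sum to zero. -/
lemma not_hasPoincareSeries_resonant_of_norm_eq_one [IsAlgClosed L] (hp : 3 < p)
    (hroot : ∀ n : ℕ, 0 < n → lam ^ n ≠ 1) (hlam : ‖lam - 1‖ < 1) {η : L} (hη : ‖η‖ = 1) :
    ¬ HasPoincareSeries lam (trinomial p lam ((lam - 1) * η) ((lam - 1) * (-1))) := by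
  intro hP
  have hE0 : 0 < ‖lam - 1‖ := norm_pos_iff.2 (sub_ne_zero.2 (by simpa using hroot 1 one_pos))
  have hprime : p.Prime := Fact.out
  have h2 : ‖(2 : L)‖ = 1 := norm_two_eq_one (p := p) (by omega)
  have h20 : (2 : L) ≠ 0 := norm_ne_zero_iff.1 (by rw [h2]; exact one_ne_zero)
  have hp1 : p - 1 + 1 = p := by omega
  set q : L[X] := X ^ (p - 1) - C η * X - 1 with hq
  have hmonic : q.Monic := monic_X_pow_sub_linear (show 1 < p - 1 by omega) η
  have hroots : ∀ x ∈ q.roots, x ^ (p - 1) = 1 + η * x := fun x hx => by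
    have h := isRoot_of_mem_roots hx
    simp only [hq, IsRoot, eval_sub, eval_pow, eval_X, eval_mul, eval_C, eval_one] at h
    linear_combination h
  have hnorm : ∀ x ∈ q.roots, ‖x‖ = 1 := fun x hx =>
    norm_eq_one_of_pow_eq (show 1 < p - 1 by omega) hη.le (hroots x hx)
  have hdeg : q.natDegree = p - 1 := by
    rw [hq, sub_sub]
    refine natDegree_sub_eq_left_of_natDegree_lt ?_ |>.trans (natDegree_X_pow _)
    rw [natDegree_X_pow]
    refine lt_of_le_of_lt (natDegree_add_le _ _) (max_lt ?_ ?_)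
    · exact (natDegree_C_mul_le η X).trans_lt (by rw [natDegree_X]; omega)
    · rw [natDegree_one]; omega
  -- The coefficient of `X ^ (p - 2)` vanishes because `p > 3` keeps that degree above the linear
  -- term.
  have hsum : q.roots.sum = 0 := by
    have h := (IsAlgClosed.splits q).nextCoeff_eq_neg_sum_roots_of_monic hmonic
    rw [nextCoeff_of_natDegree_pos (by omega), hdeg] at h
    rw [← neg_eq_zero, ← h, hq]
    simp [coeff_X_pow, coeff_X, coeff_one, show p - 1 - 1 ≠ p - 1 by omega,
      show (1 : ℕ) ≠ p - 1 - 1 by omega, show p - 1 - 1 ≠ 0 by omega]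
  have hcard : q.roots.card = p - 1 := by
    rw [← hdeg]; exact ((IsAlgClosed.splits q).natDegree_eq_card_roots).symm
  have key : ∀ x ∈ q.roots, ‖η ^ (p - 1) * (1 + η * x) - 1‖ < 1 := by
    intro x hx
    obtain ⟨i, -, hi⟩ := hP.exists_norm_fixedPoint_sub_le (by omega) hroot hlam hη.le (by simp)
      (hnorm x hx).le (by linear_combination -hroots x hx) hprime.pos
    rw [norm_pow_prime_sub_one] at hi
    have hE2 : ‖lam - 1‖ ^ 2 < ‖lam - 1‖ := by nlinarith
    have hEp : ‖lam - 1‖ ^ p < ‖lam - 1‖ :=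
      (pow_lt_pow_right_of_lt_one₀ hE0 hlam (by omega : 2 < p)).trans hE2
    -- After division by `lam - 1`, the first-order terms show that `2ηx` reduces into the prime
    -- field. Fermat's theorem and `xᵖ⁻¹ = 1 + ηx` then determine the residue of `x`.
    have h3 : ‖2 * (η * x) - (i - 1)‖ < 1 := by
      have h := norm_add_lt_of_lt (hi.trans_lt hEp)
        ((norm_pow_sub_one_sub_natCast_mul_le hlam.le i).trans_lt hE2)
      rw [show lam + 2 * ((lam - 1) * η * x) - lam ^ i + (lam ^ i - 1 - i * (lam - 1))
        = (lam - 1) * (2 * (η * x) - (i - 1)) by ring, norm_mul] at h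
      exact lt_of_mul_lt_mul_left (h.trans_eq (_root_.mul_one _).symm) hE0.le
    set y := 2 * (η * x) with hy
    have hy1 : ‖y‖ = 1 := by rw [hy, norm_mul, norm_mul, h2, hη, hnorm x hx]; norm_num
    have hcp : ((i : L) - 1) ^ p = i - 1 := by
      rw [sub_pow_char, one_pow]
      congr 1
      exact map_natCast (frobenius L p) i
    have h4 : ‖y ^ p - y‖ < 1 := by
      rw [show y ^ p - y = (y - (i - 1)) ^ p - (y - (i - 1)) by rw [sub_pow_char y, hcp]; ring]
      refine norm_sub_lt_of_lt ?_ h3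
      rw [norm_pow]; exact pow_lt_one₀ (norm_nonneg _) h3 (by omega)
    have h5 : ‖y ^ (p - 1) - 1‖ < 1 := by
      rw [← _root_.one_mul ‖y ^ (p - 1) - 1‖, ← hy1, ← norm_mul, mul_sub, ← pow_succ', hp1,
        _root_.mul_one]
      rwa [hy1]
    have h6 : (2 : L) ^ (p - 1) = 1 := by
      refine mul_right_cancel₀ h20 ?_
      rw [← pow_succ, hp1, _root_.one_mul]
      simpa [frobenius_def] using map_natCast (frobenius L p) 2
    rwa [hy, mul_pow, mul_pow, h6, hroots x hx, _root_.one_mul] at h5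
  obtain ⟨x₁, hx₁⟩ : ∃ x, x ∈ q.roots :=
    Multiset.card_pos_iff_exists_mem.1 (by rw [hcard]; omega)
  have hcong : ∀ x ∈ q.roots, ‖x - x₁‖ < 1 := fun x hx => by
    have h := norm_sub_lt_of_lt (key x hx) (key x₁ hx₁)
    rwa [show η ^ (p - 1) * (1 + η * x) - 1 - (η ^ (p - 1) * (1 + η * x₁) - 1)
      = η ^ (p - 1) * η * (x - x₁) by ring, norm_mul, norm_mul, norm_pow, hη, one_pow,
      _root_.one_mul, _root_.one_mul] at h
  have hs : ∀ s : Multiset L, (∀ t ∈ s, ‖t - x₁‖ < 1) → ‖s.sum - s.card * x₁‖ < 1 := by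
    intro s
    induction s using Multiset.induction_on with
    | empty => simp
    | cons a s ih =>
      intro hs
      rw [Multiset.sum_cons, Multiset.card_cons,
        show a + s.sum - (s.card + 1 : ℕ) * x₁ = (a - x₁) + (s.sum - s.card * x₁) by
          push_cast; ring]
      exact norm_add_lt_of_lt (hs a (by simp)) (ih fun t ht => hs t (Multiset.mem_cons_of_mem ht))
  have h := hs q.roots hcong
  rw [hsum, hcard, zero_sub, norm_neg, norm_mul, hnorm x₁ hx₁, _root_.mul_one,
    norm_natCast_eq_one (p := p) (fun h => absurd (Nat.le_of_dvd (by omega) h) (by omega))] at h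
  exact lt_irrefl _ h

end ResonantTrinomials

/-! ### The case |β| = |λ - 1|: an explicit flow. -/

section BalancedTrinomials

variable {L : Type*} [NormedField L]

/-- The iterates of the vector field `(X² + Xᵖ) d/dX` on `(X² + Xᵖ)^((p-1)/2)` in
characteristic `p`. -/
noncomputable def flowIterate (p : ℕ) (W : L[X]) (N : ℕ) : L[X] :=
  (if Even N then 1 else -X) * (-X ^ p) ^ (N / 2) * W

/-- If `V = (X² + Xᵖ)∂` and `VW = -XW`, then `V²W = -XᵖW`; as `Xᵖ` is a constant for `∂`, the
iterates have period two up to powers of `-Xᵖ`. -/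
lemma derivative_flowIterate_mul {p : ℕ} [CharP L p] {W : L[X]}
    (hW : derivative W * (X ^ 2 + X ^ p) = -X * W) (N : ℕ) :
    derivative (flowIterate p W N) * (X ^ 2 + X ^ p) = flowIterate p W (N + 1) := by
  have h0 : ∀ n, derivative ((-X ^ p : L[X]) ^ n) = 0 := fun n => by
    rw [derivative_pow, derivative_neg, derivative_X_pow, CharP.cast_eq_zero L p]; simp
  obtain ⟨n, rfl | rfl⟩ := Nat.even_or_odd' N
  · have e1 : Even (2 * n) := even_two_mul n
    have e2 : ¬ Even (2 * n + 1) := Nat.not_even_bit1 n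
    rw [flowIterate, flowIterate, if_pos e1, if_neg e2, show 2 * n / 2 = n by omega,
      show (2 * n + 1) / 2 = n by omega, derivative_mul, derivative_mul, h0, derivative_one]
    linear_combination (-X ^ p) ^ n * hW
  · have e1 : ¬ Even (2 * n + 1) := Nat.not_even_bit1 n
    have e2 : Even (2 * n + 1 + 1) := ⟨n + 1, by omega⟩
    rw [flowIterate, flowIterate, if_neg e1, if_pos e2, show (2 * n + 1) / 2 = n by omega,
      show (2 * n + 1 + 1) / 2 = n + 1 by omega, derivative_mul, derivative_mul, h0,
      derivative_neg, derivative_X, pow_succ]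
    linear_combination -X * (-X ^ p) ^ n * hW

lemma coeff_flowIterate_two_mul (p : ℕ) (W : L[X]) (n e : ℕ) :
    (flowIterate p W (n * 2)).coeff (e + n * p) = (-1) ^ n * W.coeff e := by
  have e1 : Even (n * 2) := ⟨n, by omega⟩
  rw [flowIterate, if_pos e1, show n * 2 / 2 = n by omega, neg_pow, ← pow_mul, mul_comm p,
    _root_.one_mul, mul_assoc, mul_comm (X ^ _), show ((-1 : L[X]) ^ n) = C ((-1) ^ n) by simp,
    coeff_C_mul, coeff_mul_X_pow]

variable [IsUltrametricDist L]

lemma coeffLE_flowIterate {p : ℕ} {W : L[X]} (hW : CoeffLE 1 W) (N : ℕ) : CoeffLE 1 (flowIterate p W N) := by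
  have hneg : ∀ n, CoeffLE 1 (-X ^ n : L[X]) := fun n i => by
    rw [coeff_neg, norm_neg]; exact coeffLE_X_pow n i
  refine CoeffLE.mul_one (CoeffLE.mul_one ?_ ((hneg p).pow _)) hW
  split_ifs
  · simpa using coeffLE_X_pow (L := L) 0
  · simpa using hneg 1

variable {lam : L}

/-- The second-order Taylor remainder has size `|μ|²`, while the linear term `(λ - 1)X` and the
shift `λᴺ - 1` contribute at most `|λ - 1|`; then divide by `μ`. -/
lemma coeffLE_shift_step {μ : L} (hμ0 : μ ≠ 0) (hμ : ‖μ‖ ≤ 1) (hE : ‖lam - 1‖ ≤ ‖μ‖) {φ G : L[X]}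
    (hφ : CoeffLE 1 φ) (hG : CoeffLE 1 G) (N : ℕ) :
    CoeffLE (max ‖μ‖ (‖lam - 1‖ / ‖μ‖))
      (μ⁻¹ • (G.comp (C lam * X + C μ * φ) - C (lam ^ N) * G) - derivative G * φ) := by
  set τ := max ‖μ‖ (‖lam - 1‖ / ‖μ‖) with hτ
  have hμ' : 0 < ‖μ‖ := norm_pos_iff.2 hμ0
  have hτ1 : ‖μ‖ * ‖μ‖ * 1 ≤ ‖μ‖ * τ := by
    rw [_root_.mul_one]; exact mul_le_mul_of_nonneg_left (le_max_left _ _) hμ'.le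
  have hτ2 : ‖lam - 1‖ ≤ ‖μ‖ * τ := by
    refine le_trans (le_of_eq ?_) (mul_le_mul_of_nonneg_left (le_max_right _ _) hμ'.le)
    field_simp
  have hμφ : CoeffLE ‖μ‖ (C μ * φ) := (coeffLE_C μ).mul_one hφ
  have hEX : CoeffLE ‖lam - 1‖ (C (lam - 1) * X) := (coeffLE_C _).mul_one coeffLE_X
  set f : L[X] := C lam * X + C μ * φ with hf
  have hfX : f - X = C (lam - 1) * X + C μ * φ := by rw [hf, C_sub, C_1]; ring
  have hδ : CoeffLE ‖μ‖ (f - X) := by rw [hfX]; exact (hEX.mono hE).add hμφ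
  have hf1 : CoeffLE 1 f := by
    have := (hδ.mono hμ).add coeffLE_X
    rwa [sub_add_cancel] at this
  have h1 := (hf1.aeval_taylor hδ hG).mono hτ1
  have h2 : CoeffLE (‖μ‖ * τ) (derivative G * (C (lam - 1) * X)) :=
    (hG.derivative.one_mul hEX).mono hτ2
  have h3 : CoeffLE (‖μ‖ * τ) (C (lam ^ N - 1) * G) := by
    refine ((coeffLE_C _).mul_one hG).mono (le_trans ?_ hτ2)
    have hlam1 : ‖lam‖ ≤ 1 := by
      simpa using norm_add_le_of_le (hE.trans hμ) (norm_one (α := L)).le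
    simpa using norm_pow_sub_pow_le hlam1 (norm_one (α := L)).le N
  refine CoeffLE.of_smul hμ0 ?_
  have e : μ • (μ⁻¹ • (G.comp f - C (lam ^ N) * G) - derivative G * φ)
      = (Polynomial.aeval f G - G - derivative G * (f - X)) + derivative G * (C (lam - 1) * X)
        - C (lam ^ N - 1) * G := by
    rw [smul_sub, smul_inv_smul₀ hμ0, comp_eq_aeval, hfX, C_sub (a := lam ^ N), C_1, smul_eq_C_mul]
    ring
  rw [e]
  exact (h1.add h2).sub h3

variable {p : ℕ} [CharP L p]

/-- Errors do not accumulate: the vector field is integral, so it preserves the old error bound, and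
each new error obeys the same bound in an ultrametric sum. -/
lemma coeffLE_shiftProd_sub_flowIterate {μ : L} (hμ0 : μ ≠ 0) (hμ : ‖μ‖ ≤ 1)
    (hE : ‖lam - 1‖ ≤ ‖μ‖) {W : L[X]} (hW1 : CoeffLE 1 W)
    (hW : derivative W * (X ^ 2 + X ^ p) = -X * W) (N : ℕ) :
    CoeffLE (max ‖μ‖ (‖lam - 1‖ / ‖μ‖))
      ((μ ^ N)⁻¹ • shiftProd (trinomial p lam μ μ) lam 0 N W - flowIterate p W N) := by
  have hμ' : 0 < ‖μ‖ := norm_pos_iff.2 hμ0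
  set τ := max ‖μ‖ (‖lam - 1‖ / ‖μ‖) with hτ
  have hτ1 : τ ≤ 1 := max_le hμ ((div_le_one hμ').2 hE)
  have hφ : CoeffLE 1 (X ^ 2 + X ^ p : L[X]) := (coeffLE_X_pow 2).add (coeffLE_X_pow p)
  have hf : trinomial p lam μ μ = C lam * X + C μ * (X ^ 2 + X ^ p) := by rw [trinomial]; ring
  induction N with
  | zero => simpa [shiftProd, flowIterate] using coeffLE_zero (hμ'.le.trans (le_max_left _ _))
  | succ N ih =>
    set r := (μ ^ N)⁻¹ • shiftProd (trinomial p lam μ μ) lam 0 N W with hr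
    have hr1 : CoeffLE 1 r := by
      have := (ih.mono hτ1).add (coeffLE_flowIterate (p := p) hW1 N)
      rwa [sub_add_cancel] at this
    have e : (μ ^ (N + 1))⁻¹ • shiftProd (trinomial p lam μ μ) lam 0 (N + 1) W
        = μ⁻¹ • (r.comp (C lam * X + C μ * (X ^ 2 + X ^ p)) - C (lam ^ N) * r) := by
      rw [shiftProd, hr, smul_comp, zero_add, ← hf, mul_smul_comm, ← smul_sub, smul_smul,
        pow_succ', mul_inv]
    rw [e, ← derivative_flowIterate_mul hW, ← sub_add_sub_cancel _ (derivative r * (X ^ 2 + X ^ p)),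
      ← sub_mul, ← derivative_sub]
    exact (coeffLE_shift_step hμ0 hμ hE hφ hr1 N).add (ih.derivative.mul_one hφ)

lemma not_hasPoincareSeries_balanced [Fact p.Prime] (hp : 2 < p) {μ : L} (hEμ : ‖lam - 1‖ < ‖μ‖) (hμ : ‖μ‖ < 1) :
    ¬ HasPoincareSeries lam (trinomial p lam μ μ) := by
  intro hP
  have hμ' : 0 < ‖μ‖ := (norm_nonneg _).trans_lt hEμ
  have hμ0 : μ ≠ 0 := norm_pos_iff.1 hμ'
  obtain ⟨k, hk⟩ := (Fact.out : p.Prime).odd_of_ne_two (by omega)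
  -- The exponent `k = (p - 1) / 2` is `-1/2` in the field, which makes `W` satisfy the differential
  -- equation `VW = -XW`.
  set W : L[X] := (X ^ 2 + X ^ p) ^ k with hWdef
  have hW1 : CoeffLE 1 W := CoeffLE.pow ((coeffLE_X_pow 2).add (coeffLE_X_pow p)) k
  have hW : derivative W * (X ^ 2 + X ^ p) = -X * W := by
    have h2k : (2 * k : L[X]) = -1 := by
      have h : ((2 * k + 1 : ℕ) : L[X]) = 0 := by rw [← hk]; exact CharP.cast_eq_zero _ p
      push_cast at h
      linear_combination h
    have hk0 : k - 1 + 1 = k := by omega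
    rw [hWdef, derivative_pow, derivative_add, derivative_X_pow, derivative_X_pow,
      CharP.cast_eq_zero L p]
    calc _ = (2 * k : L[X]) * X * (X ^ 2 + X ^ p) ^ (k - 1 + 1) := by
          simp only [map_zero, zero_mul, add_zero, map_natCast, Nat.cast_ofNat, map_ofNat, pow_succ]
          ring
      _ = _ := by rw [h2k, hk0]; ring
  have hWc : W.coeff (p - 1) = 1 := by
    have e : W = (1 + X ^ (p - 2)) ^ k * X ^ (p - 1) := by
      rw [hWdef, show p - 1 = 2 * k by omega, pow_mul, ← mul_pow]
      congr 1
      rw [add_mul, ← pow_add, _root_.one_mul, Nat.sub_add_cancel hp.le]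
    have h := coeff_mul_X_pow ((1 + X ^ (p - 2) : L[X]) ^ k) (p - 1) 0
    rw [zero_add] at h
    rw [e, h, coeff_zero_eq_eval_zero]
    simp [show p - 2 ≠ 0 by omega]
  refine hP.not_pow_le (p := p) (hEμ.trans hμ) two_pos (F := W) (e₀ := p - 1) (e₁ := p)
    (θ := ‖μ‖ ^ 2) (by positivity) fun N => ?_
  have h := coeffLE_shiftProd_sub_flowIterate (p := p) hμ0 hμ.le hEμ.le hW1 hW (N * 2)
    (p - 1 + N * p)
  rw [coeff_sub, coeff_flowIterate_two_mul, hWc, _root_.mul_one, coeff_smul, smul_eq_mul] at h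
  have h1 : ‖((-1 : L) ^ N)‖ = 1 := by simp
  have h2 := norm_eq_of_norm_sub_lt ((h.trans_lt (max_lt hμ ((div_lt_one hμ').2 hEμ))).trans_eq
    h1.symm)
  rw [h1, norm_mul, norm_inv, norm_pow] at h2
  rw [← pow_mul, mul_comm 2 N]
  exact le_of_eq (by field_simp at h2; exact h2.symm)

end BalancedTrinomials

/-! ### Case distinction on the scaling invariant. -/

/-- Over an algebraically closed field, a trinomial with a quadratic term has no convergent
Poincaré series. -/
theorem not_hasPoincareSeries_trinomial {L : Type*} [NormedField L] [IsUltrametricDist L]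
    [IsAlgClosed L] {p : ℕ} [Fact p.Prime] [CharP L p] (hp : 3 < p) {lam : L}
    (hroot : ∀ n : ℕ, 0 < n → lam ^ n ≠ 1) (hlam : ‖lam - 1‖ < 1) {b : L} (hb : b ≠ 0) (a : L) :
    ¬ HasPoincareSeries lam (trinomial p lam b a) := by
  intro hP
  have hE : lam - 1 ≠ 0 := sub_ne_zero.2 (by simpa using hroot 1 one_pos)
  have hE0 : 0 < ‖lam - 1‖ := norm_pos_iff.2 hE
  set E := lam - 1 with hEdef
  obtain ⟨k, rfl⟩ : ∃ k, p = k + 4 := ⟨p - 4, by omega⟩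
  set β := a * E ^ (k + 2) / b ^ (k + 3) with hβ
  have ha : β ≠ 0 → a ≠ 0 := by
    rintro h rfl
    exact h (by rw [hβ]; simp)
  rcases lt_or_ge ‖β‖ 1 with h1 | h1
  · by_cases h2 : ‖β‖ = ‖E‖
    · have ha0 : a ≠ 0 := ha (norm_ne_zero_iff.1 (by rw [h2]; exact hE0.ne'))
      -- This scaling makes the two nonlinear coefficients equal.
      obtain ⟨ρ, hρ⟩ := IsAlgClosed.exists_pow_nat_eq (b / a) (show 0 < k + 2 by omega)
      have hρ0 : ρ ≠ 0 := by
        rintro rfl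
        rw [zero_pow (by omega)] at hρ
        exact div_ne_zero hb ha0 hρ.symm
      have h := hP.scale (by omega) hρ0
      have e : a * ρ ^ (k + 4 - 1) = b * ρ := by
        rw [show k + 4 - 1 = (k + 2) + 1 by omega, pow_succ, hρ]; field_simp
      rw [e] at h
      -- Thus the common coefficient has norm `|E|^((p-3)/(p-2))`, strictly between `|E|` and `1`.
      have hμ : ‖b * ρ‖ ^ (k + 2) * ‖E‖ = ‖E‖ ^ (k + 2) := by
        rw [← norm_pow, ← norm_pow, ← h2, ← norm_mul]
        congr 1
        rw [mul_pow, hρ, hβ, pow_succ b (k + 2)]; field_simp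
      refine not_hasPoincareSeries_balanced (by omega) ?_ ?_ h
      · by_contra! h3
        have h4 := mul_le_mul_of_nonneg_right
          (pow_le_pow_left₀ (norm_nonneg _) h3 (k + 2)) hE0.le
        rw [hμ] at h4
        exact absurd h4 (not_le.2 (mul_lt_of_lt_one_right (by positivity) hlam))
      · by_contra! h3
        have h4 := mul_le_mul_of_nonneg_right (one_le_pow₀ h3 (n := k + 2)) hE0.le
        rw [hμ, _root_.one_mul] at h4
        exact absurd h4 (not_le.2 (pow_lt_self_of_lt_one₀ hE0 hlam (by omega)))
    · have h := hP.scale (by omega) (div_ne_zero hE hb)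
      have e1 : b * (E / b) = E := by field_simp
      have e2 : a * (E / b) ^ (k + 4 - 1) = E * β := by
        rw [hβ, show k + 4 - 1 = k + 3 by omega, div_pow]; ring
      rw [e1, e2] at h
      exact not_hasPoincareSeries_of_norm_lt_one (by omega) hroot hlam h1 h2 h
  · have ha0 : a ≠ 0 := ha (norm_pos_iff.1 (by linarith))
    -- This scaling makes the top coefficient `-E`, so that the quadratic one is `Eη` with
    -- `|η|ᵖ⁻¹|β| = 1`.
    obtain ⟨ρ, hρ⟩ := IsAlgClosed.exists_pow_nat_eq (-E / a) (show 0 < k + 3 by omega)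
    have hρ0 : ρ ≠ 0 := by
      rintro rfl
      rw [zero_pow (by omega)] at hρ
      exact div_ne_zero (neg_ne_zero.2 hE) ha0 hρ.symm
    have h := hP.scale (by omega) hρ0
    have e1 : b * ρ = E * (b * ρ / E) := by field_simp
    have e2 : a * ρ ^ (k + 4 - 1) = E * (-1) := by
      rw [show k + 4 - 1 = k + 3 by omega, hρ]; field_simp
    rw [e1, e2] at h
    have hη : ‖b * ρ / E‖ ^ (k + 3) * ‖β‖ = 1 := by
      rw [← norm_pow, ← norm_mul, ← norm_one (α := L), ← norm_neg (1 : L)]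
      congr 1
      rw [div_pow, mul_pow, hρ, hβ, pow_succ E]; field_simp
    have hη1 : ‖b * ρ / E‖ ≤ 1 := by
      by_contra! h3
      have h4 := one_lt_pow₀ h3 (show k + 3 ≠ 0 by omega)
      nlinarith
    rcases hη1.lt_or_eq with h3 | h3
    · exact not_hasPoincareSeries_resonant_of_norm_lt_one (by omega) hroot hlam
        (div_ne_zero (mul_ne_zero hb hρ0) hE) h3 h
    · exact not_hasPoincareSeries_resonant_of_norm_eq_one (by omega) hroot hlam h3 h

/-! ### From a linearization to a Poincaré series, and passage to the algebraic closure. -/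

section Inversion

lemma coeff_subst_eq_sum {R : Type*} [CommRing R] {b : PowerSeries R}
    (hb : PowerSeries.constantCoeff b = 0) (F : PowerSeries R) (n : ℕ) :
    PowerSeries.coeff n (F.subst b)
      = ∑ i ∈ range (n + 1), PowerSeries.coeff i F * PowerSeries.coeff n (b ^ i) := by
  rw [PowerSeries.coeff_subst' (PowerSeries.HasSubst.of_constantCoeff_zero' hb)]
  refine finsum_eq_sum_of_support_subset _ fun i hi => ?_
  by_contra h
  simp only [coe_range, Set.mem_Iio, not_lt] at h
  refine hi ?_
  change _ • _ = _
  rw [PowerSeries.X_pow_dvd_iff.1 (pow_dvd_pow_of_dvd (PowerSeries.X_dvd_iff.2 hb) i) n h, smul_zero]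

variable {K : Type*} [NormedField K]

lemma IsLocallyAnalytic.exists_norm_coeff_le {h : PowerSeries K} (hh : IsLocallyAnalytic h) {b : K}
    (hb : b ≠ 0) (h1 : PowerSeries.coeff 1 h = b) :
    ∃ r : ℝ, 0 < r ∧ ∀ n, ‖b⁻¹ * PowerSeries.coeff (n + 1) h‖ ≤ r ^ n := by
  obtain ⟨s, hs, hr⟩ := hh
  obtain ⟨M, hM⟩ := ((PowerSeries.isRestricted_iff' _ _).1 hr).bddAbove_range
  have hM : ∀ n, ‖PowerSeries.coeff n h‖ * s ^ n ≤ M := fun n => hM ⟨n, rfl⟩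
  have hb' : 0 < ‖b‖ := norm_pos_iff.2 hb
  set D := max 1 (M / (‖b‖ * s)) with hD
  refine ⟨D / s, by positivity, fun n => ?_⟩
  rcases n.eq_zero_or_pos with rfl | hn
  · simp [h1, hb]
  · have h2 : ‖b⁻¹ * PowerSeries.coeff (n + 1) h‖ * s ^ n ≤ M / (‖b‖ * s) := by
      rw [le_div_iff₀ (by positivity), norm_mul, norm_inv]
      refine le_trans (le_of_eq ?_) (hM (n + 1))
      rw [pow_succ]; field_simp
    rw [div_pow, le_div_iff₀ (by positivity)]
    exact (h2.trans (le_max_right _ _)).trans (le_self_pow₀ (le_max_left _ _) hn.ne')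

/-- A linearizable polynomial has a convergent Poincaré series, the inverse of the linearization. -/
lemma IsLinearizable.hasPoincareSeries [IsUltrametricDist K] {f : K[X]} (hf0 : f.coeff 0 = 0)
    (hf : IsLinearizable (f : PowerSeries K)) : HasPoincareSeries (f.coeff 1) f := by
  obtain ⟨h, hb, hh, h0, heq⟩ := hf
  set lam := f.coeff 1
  set ψ := h.substInvOfIsUnit hb with hψ
  have hψ0 : PowerSeries.constantCoeff ψ = 0 := PowerSeries.constantCoeff_substInvOfIsUnit _ _
  have hsψ : PowerSeries.HasSubst ψ := PowerSeries.HasSubst.substInvOfIsUnit _ _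
  have hsh : PowerSeries.HasSubst h := PowerSeries.HasSubst.of_constantCoeff_zero' h0
  have hψh : ψ.subst h = PowerSeries.X := PowerSeries.subst_substInvOfIsUnit_left _ h0 hb
  set b := PowerSeries.coeff 1 h with hbdef
  have hb0 : b ≠ 0 := hb.ne_zero
  have hfψ : aeval ψ f = PowerSeries.rescale lam ψ := by
    have hg0 : PowerSeries.constantCoeff ((f : PowerSeries K).subst ψ) = 0 := by
      refine PowerSeries.constantCoeff_subst_eq_zero hψ0 _ ?_
      simpa using hf0
    have e := congrArg (fun g => ψ.subst g) heq
    rw [← PowerSeries.subst_coe hsψ, PowerSeries.rescale_eq_subst, PowerSeries.smul_eq_C_mul]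
    refine Eq.trans ?_ (e.trans (by simp [lam]))
    change _ = PowerSeries.subst (PowerSeries.subst _ h) ψ
    have hsg := PowerSeries.HasSubst.of_constantCoeff_zero' hg0
    rw [← PowerSeries.subst_comp_subst_apply hsh hsg, hψh, PowerSeries.subst_X hsg]
  obtain ⟨r, hr, hbound⟩ := hh.exists_norm_coeff_le hb0 rfl
  have hone : PowerSeries.coeff 1 ψ = b⁻¹ := by
    rw [hψ, PowerSeries.coeff_one_substInvOfIsUnit]; simp [hbdef]
  refine ⟨PowerSeries.rescale b ψ, ?_, ?_, ⟨r, hr, fun n => ?_⟩, ?_⟩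
  · simpa using hψ0
  · rw [PowerSeries.coeff_rescale, hone, pow_one, mul_inv_cancel₀ hb0]
  · have key := norm_le_of_triangular hr (inv_nonneg.2 hr.le) (ψ := b⁻¹ • h) (by simp [h0])
      (by simp [← hbdef, hb0]) (by simpa using hbound)
      (fun i => PowerSeries.coeff i (PowerSeries.rescale b ψ)) (fun n => ?_) (n + 1)
    · rwa [pow_succ', inv_mul_cancel_left₀ hr.ne'] at key
    · have e : ∑ i ∈ range (n + 1), PowerSeries.coeff i (PowerSeries.rescale b ψ)
          * PowerSeries.coeff n ((b⁻¹ • h) ^ i) = PowerSeries.coeff n (PowerSeries.X : PowerSeries K) := by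
        rw [← hψh, coeff_subst_eq_sum h0]
        refine sum_congr rfl fun i _ => ?_
        rw [_root_.smul_pow, map_smul, PowerSeries.coeff_rescale, smul_eq_mul, inv_pow]
        field_simp
      rw [e, PowerSeries.coeff_X]
      split_ifs with hn
      · rw [hn, pow_one, inv_mul_cancel₀ hr.ne', norm_one]
      · rw [norm_zero]; positivity
  · have e := congrArg (PowerSeries.rescaleAlgHom b) hfψ
    have hr : ∀ φ, PowerSeries.rescaleAlgHom b φ = PowerSeries.rescale b φ :=
      DFunLike.congr_fun (PowerSeries.coe_rescaleAlgHom b)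
    rw [← aeval_algHom_apply, hr, hr] at e
    rw [e]
    ext n
    simp only [PowerSeries.coeff_rescale]
    ring

lemma HasPoincareSeries.map {L : Type*} [NormedField L] {φ : K →+* L} (hφ : ∀ x, ‖φ x‖ = ‖x‖)
    {lam : K} {f : K[X]} (h : HasPoincareSeries lam f) : HasPoincareSeries (φ lam) (f.map φ) := by
  obtain ⟨ψ, h0, h1, ⟨r, hr, hψ⟩, hf⟩ := h
  refine ⟨PowerSeries.map φ ψ, by rw [PowerSeries.coeff_map, h0, map_zero],
    by rw [PowerSeries.coeff_map, h1, map_one],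
    ⟨r, hr, fun n => by rw [PowerSeries.coeff_map, hφ]; exact hψ n⟩, ?_⟩
  have e := congrArg (PowerSeries.map φ) hf
  rw [aeval_def, hom_eval₂] at e
  have e1 : (PowerSeries.map φ).comp (algebraMap K (PowerSeries K))
      = (algebraMap L (PowerSeries L)).comp φ := by
    ext x : 1
    simp
  rw [aeval_def, eval₂_map, ← e1, e]
  ext n
  simp

/-- The fixed points and scaling factors live in the algebraic closure; completeness provides the
spectral norm there, and the Poincaré series transfers with its bounds. -/
lemma not_hasPoincareSeries_trinomial_of_complete {K : Type*} [NontriviallyNormedField K]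
    [IsUltrametricDist K] [CompleteSpace K] {p : ℕ} [Fact p.Prime] [CharP K p] (hp : 3 < p)
    {lam : K} (hroot : ∀ n : ℕ, 0 < n → lam ^ n ≠ 1) (hlam : ‖lam - 1‖ < 1) {b : K} (hb : b ≠ 0)
    (a : K) : ¬ HasPoincareSeries lam (trinomial p lam b a) := by
  intro hP
  let _ : NormedField (AlgebraicClosure K) := spectralNorm.normedField K (AlgebraicClosure K)
  have _ : IsUltrametricDist (AlgebraicClosure K) :=
    IsUltrametricDist.isUltrametricDist_of_forall_norm_add_le_max_norm
      (isNonarchimedean_spectralNorm (K := K) (L := AlgebraicClosure K))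
  have _ : CharP (AlgebraicClosure K) p := charP_of_injective_algebraMap
    (algebraMap K (AlgebraicClosure K)).injective p
  have hφ : ∀ x : K, ‖algebraMap K (AlgebraicClosure K) x‖ = ‖x‖ := fun x =>
    spectralNorm_extends x
  have h := hP.map hφ
  have e : (trinomial p lam b a).map (algebraMap K (AlgebraicClosure K))
      = trinomial p (algebraMap K _ lam) (algebraMap K _ b) (algebraMap K _ a) := by
    simp [trinomial]
  rw [e] at h
  refine not_hasPoincareSeries_trinomial hp (fun n hn h1 => hroot n hn ?_) ?_ ?_ _ h
  · refine (algebraMap K (AlgebraicClosure K)).injective ?_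
    rw [map_pow, h1, map_one]
  · rw [← map_one (algebraMap K (AlgebraicClosure K)), ← map_sub, hφ]; exact hlam
  · exact (_root_.map_ne_zero _).2 hb

end Inversion

/-! ### The converse: linearizing an additive polynomial. -/

section Frobenius

variable {K : Type*} [NormedField K]

/-- The coefficients of the linearization of `lam X + a Xᵖ` at the exponents `pᵏ`. -/
noncomputable def linearizationCoeff (p : ℕ) (lam a : K) : ℕ → K
  | 0 => 1
  | k + 1 => -(linearizationCoeff p lam a k * a ^ p ^ k) / (lam ^ p ^ (k + 1) - lam)

/-- The linearization of `lam X + a Xᵖ`. -/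
noncomputable def linearization (p : ℕ) (lam a : K) : PowerSeries K := PowerSeries.mk fun n =>
  if p ^ Nat.log p n = n then linearizationCoeff p lam a (Nat.log p n) else 0

variable {p : ℕ} {lam a : K}

lemma coeff_linearization_of_forall_ne {n : ℕ} (h : ∀ k, p ^ k ≠ n) :
    PowerSeries.coeff n (linearization p lam a) = 0 := by
  rw [linearization, PowerSeries.coeff_mk, if_neg (h _)]

variable [hp : Fact p.Prime]

lemma coeff_linearization_pow (k : ℕ) :
    PowerSeries.coeff (p ^ k) (linearization p lam a) = linearizationCoeff p lam a k := by
  rw [linearization, PowerSeries.coeff_mk, Nat.log_pow hp.out.one_lt, if_pos rfl]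

lemma coeff_one_linearization : PowerSeries.coeff 1 (linearization p lam a) = 1 := by
  simpa [linearizationCoeff] using coeff_linearization_pow (p := p) (lam := lam) (a := a) 0

lemma constantCoeff_linearization : PowerSeries.constantCoeff (linearization p lam a) = 0 := by
  rw [← PowerSeries.coeff_zero_eq_constantCoeff_apply]
  exact coeff_linearization_of_forall_ne fun k => (pow_pos hp.out.pos k).ne'

variable [CharP K p]

/-- Since `pᵏ⁺¹ - 1` is prime to `p`, every denominator has norm exactly `|λ - 1|`. -/
lemma norm_linearizationCoeff_le [IsUltrametricDist K] (hlam0 : lam ≠ 1) (hlam : ‖lam - 1‖ < 1)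
    (k : ℕ) : ‖linearizationCoeff p lam a k‖ ≤ (max 1 ‖a‖ / ‖lam - 1‖) ^ p ^ k := by
  have hE0 : 0 < ‖lam - 1‖ := norm_pos_iff.2 (sub_ne_zero.2 hlam0)
  set R := max 1 ‖a‖ / ‖lam - 1‖ with hR
  have hR1 : 1 ≤ R := (one_le_div hE0).2 (hlam.le.trans (le_max_left _ _))
  induction k with
  | zero => simpa [linearizationCoeff] using hR1
  | succ k ih =>
    have hden : ‖lam ^ p ^ (k + 1) - lam‖ = ‖lam - 1‖ := by
      have hpos : 0 < p ^ (k + 1) := pow_pos hp.out.pos _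
      have hnd : ¬ p ∣ p ^ (k + 1) - 1 := fun h => by
        have h1 := (Nat.dvd_sub_iff_right hpos (dvd_pow_self p k.succ_ne_zero)).1 h
        exact hp.out.one_lt.ne' (Nat.dvd_one.1 h1)
      have e : lam ^ p ^ (k + 1) - lam = lam * (lam ^ (p ^ (k + 1) - 1) - 1) := by
        rw [mul_sub, ← pow_succ', Nat.sub_add_cancel hpos, _root_.mul_one]
      rw [e, norm_mul, norm_eq_one_of_norm_sub_one_lt hlam, _root_.one_mul,
        norm_pow_sub_one_of_not_dvd hlam hnd]
    have hpk : p ^ k ≠ 0 := (pow_pos hp.out.pos k).ne'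
    rw [linearizationCoeff, norm_div, norm_neg, norm_mul, norm_pow, hden, mul_div_assoc]
    have h1 : ‖a‖ ^ p ^ k / ‖lam - 1‖ ≤ R ^ p ^ k := by
      rw [hR, div_pow]
      exact div_le_div₀ (by positivity)
        (pow_le_pow_left₀ (norm_nonneg _) (le_max_right _ _) _) (by positivity)
        (pow_le_of_le_one hE0.le hlam.le hpk)
    calc _ ≤ R ^ p ^ k * R ^ p ^ k := mul_le_mul ih h1 (by positivity) (by positivity)
      _ = R ^ (p ^ k * 2) := by rw [← pow_add]; congr 1; ring
      _ ≤ R ^ p ^ (k + 1) := pow_le_pow_right₀ hR1 (by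
          rw [pow_succ]; exact Nat.mul_le_mul_left _ hp.out.two_le)

lemma isLocallyAnalytic_linearization [IsUltrametricDist K] (hlam0 : lam ≠ 1)
    (hlam : ‖lam - 1‖ < 1) : IsLocallyAnalytic (linearization p lam a) := by
  have hE0 : 0 < ‖lam - 1‖ := norm_pos_iff.2 (sub_ne_zero.2 hlam0)
  set R := max 1 ‖a‖ / ‖lam - 1‖ with hR
  have hR0 : 0 < R := by positivity
  refine ⟨R⁻¹ * 2⁻¹, by positivity, (PowerSeries.isRestricted_iff' _ _).2 ?_⟩
  have hle : ∀ n, ‖PowerSeries.coeff n (linearization p lam a)‖ ≤ R ^ n := fun n => by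
    by_cases h : ∃ k, p ^ k = n
    · obtain ⟨k, rfl⟩ := h
      rw [coeff_linearization_pow]
      exact norm_linearizationCoeff_le hlam0 hlam k
    · push Not at h
      rw [coeff_linearization_of_forall_ne h, norm_zero]
      positivity
  refine squeeze_zero (fun n => by positivity) (fun n => ?_)
    (tendsto_pow_atTop_nhds_zero_of_lt_one (r := (2⁻¹ : ℝ)) (by norm_num) (by norm_num))
  rw [mul_pow, ← mul_assoc]
  refine mul_le_of_le_one_left (by positivity) ?_
  rw [inv_pow, ← div_eq_mul_inv]
  exact (div_le_one (by positivity)).2 (hle n)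

lemma coeff_binomial_pow (k n : ℕ) :
    PowerSeries.coeff n ((PowerSeries.C lam * PowerSeries.X + PowerSeries.C a * PowerSeries.X ^ p :
      PowerSeries K) ^ p ^ k)
      = (if n = p ^ k then lam ^ p ^ k else 0) + if n = p ^ (k + 1) then a ^ p ^ k else 0 := by
  have : CharP (PowerSeries K) p :=
    charP_of_injective_ringHom (f := PowerSeries.C (R := K)) PowerSeries.C_injective p
  rw [add_pow_char_pow, mul_pow, mul_pow, ← map_pow, ← map_pow, ← pow_mul, ← pow_succ', map_add,
    PowerSeries.coeff_C_mul, PowerSeries.coeff_C_mul, PowerSeries.coeff_X_pow,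
    PowerSeries.coeff_X_pow]
  simp

/-- By additivity of Frobenius only exponents `pᵏ` occur, and the coefficient at `pᵏ⁺¹` receives
just the terms of index `pᵏ` and `pᵏ⁺¹`; the recursion defining the coefficients is this identity
solved for the latter. -/
lemma subst_linearization (hlam0 : lam ≠ 0) (hroot : ∀ n : ℕ, 0 < n → lam ^ n ≠ 1) :
    (linearization p lam a).subst (PowerSeries.C lam * PowerSeries.X
      + PowerSeries.C a * PowerSeries.X ^ p : PowerSeries K) = lam • linearization p lam a := by
  set f : PowerSeries K := PowerSeries.C lam * PowerSeries.X + PowerSeries.C a * PowerSeries.X ^ p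
    with hf
  have hf0 : PowerSeries.constantCoeff f = 0 := by simp [hf, hp.out.ne_zero]
  have hinj : Function.Injective (p ^ · : ℕ → ℕ) := Nat.pow_right_injective hp.out.two_le
  have hterm : ∀ n i, PowerSeries.coeff i (linearization p lam a) * PowerSeries.coeff n (f ^ i) ≠ 0 →
      ∃ k, i = p ^ k ∧ (n = p ^ k ∨ n = p ^ (k + 1)) := fun n i h => by
    by_cases hi : ∃ k, p ^ k = i
    · obtain ⟨k, rfl⟩ := hi
      refine ⟨k, rfl, ?_⟩
      by_contra! hn
      rw [coeff_binomial_pow, if_neg hn.1, if_neg hn.2, add_zero, mul_zero] at h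
      exact h rfl
    · push Not at hi
      rw [coeff_linearization_of_forall_ne hi, zero_mul] at h
      exact absurd rfl h
  ext n
  rw [PowerSeries.coeff_subst' (PowerSeries.HasSubst.of_constantCoeff_zero' hf0), map_smul,
    smul_eq_mul]
  simp only [smul_eq_mul]
  by_cases hn : ∃ k, p ^ k = n
  · obtain ⟨k, rfl⟩ := hn
    cases k with
    | zero =>
      rw [finsum_eq_single _ (p ^ 0) fun i hi => ?_]
      · rw [coeff_binomial_pow, if_pos rfl, if_neg fun h => absurd (hinj h) (by omega)]
        simp
        ring
      · by_contra h
        obtain ⟨k, rfl, h1 | h1⟩ := hterm _ _ h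
        · exact hi h1.symm
        · exact absurd (hinj h1) (by omega)
    | succ k =>
      have hne : p ^ k ≠ p ^ (k + 1) := fun h => absurd (hinj h) (by omega)
      rw [finsum_eq_sum_of_support_subset (s := {p ^ k, p ^ (k + 1)}) _ fun i hi => ?_,
        sum_pair hne]
      · rw [coeff_binomial_pow, coeff_binomial_pow, if_neg hne.symm, if_pos rfl, if_pos rfl,
          if_neg fun h => absurd (hinj h) (by omega), coeff_linearization_pow,
          coeff_linearization_pow, linearizationCoeff]
        have hden : lam ^ p ^ (k + 1) - lam ≠ 0 := by
          have h1 : 1 < p ^ (k + 1) := Nat.one_lt_pow k.succ_ne_zero hp.out.one_lt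
          rw [show lam ^ p ^ (k + 1) - lam = lam * (lam ^ (p ^ (k + 1) - 1) - 1) by
            rw [mul_sub, ← pow_succ', Nat.sub_add_cancel h1.le, _root_.mul_one]]
          exact mul_ne_zero hlam0 (sub_ne_zero.2 (hroot _ (by omega)))
        field_simp
        ring
      · obtain ⟨j, rfl, h1 | h1⟩ := hterm _ _ hi
        · simp [hinj h1]
        · have : k = j := by have := hinj h1; omega
          simp [this]
  · push Not at hn
    rw [coeff_linearization_of_forall_ne hn, mul_zero]
    refine finsum_eq_zero_of_forall_eq_zero fun i => ?_
    by_contra h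
    obtain ⟨k, -, h1 | h1⟩ := hterm _ _ h
    exacts [hn _ h1.symm, hn _ h1.symm]

lemma isLinearizable_binomial [IsUltrametricDist K] (hroot : ∀ n : ℕ, 0 < n → lam ^ n ≠ 1)
    (hlam : ‖lam - 1‖ < 1) : IsLinearizable (PowerSeries.C lam * PowerSeries.X
      + PowerSeries.C a * PowerSeries.X ^ p : PowerSeries K) := by
  have hb : IsUnit (PowerSeries.coeff 1 (linearization p lam a)) := by
    rw [coeff_one_linearization]; exact isUnit_one
  refine ⟨linearization p lam a, hb, isLocallyAnalytic_linearization
    (by simpa using hroot 1 one_pos) hlam, constantCoeff_linearization, ?_⟩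
  set f : PowerSeries K := PowerSeries.C lam * PowerSeries.X + PowerSeries.C a * PowerSeries.X ^ p
    with hf
  have hf0 : PowerSeries.constantCoeff f = 0 := by simp [hf, hp.out.ne_zero]
  have hf1 : PowerSeries.coeff 1 f = lam := by
    simp [hf, PowerSeries.coeff_X_pow, hp.out.one_lt.ne]
  have hlam0 : lam ≠ 0 :=
    norm_ne_zero_iff.1 (by rw [norm_eq_one_of_norm_sub_one_lt hlam]; exact one_ne_zero)
  have hs := PowerSeries.HasSubst.substInvOfIsUnit (linearization p lam a) hb
  rw [← PowerSeries.subst_comp_subst_apply (PowerSeries.HasSubst.of_constantCoeff_zero' hf0) hs,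
    subst_linearization hlam0 hroot, PowerSeries.subst_smul hs,
    PowerSeries.subst_substInvOfIsUnit_right _ constantCoeff_linearization, hf1,
    PowerSeries.smul_eq_C_mul]

end Frobenius

end NonArchLinearization

theorem theorem1p5 {K : Type*} [NormedField K] [IsUltrametricDist K] [CompleteSpace K]
    (p : ℕ) [Fact p.Prime] [CharP K p] (hp : 5 ≤ p)
    (lam : K) (hroot : ∀ n : ℕ, 0 < n → lam ^ n ≠ 1) (hlam : ‖1 - lam‖ < 1)
    (a₁ a : K) :
    NonArchLinearization.IsLinearizable
      (PowerSeries.C lam * PowerSeries.X + PowerSeries.C a₁ * PowerSeries.X ^ 2 +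
        PowerSeries.C a * PowerSeries.X ^ p) ↔ a₁ = 0 := by
  rw [norm_sub_rev] at hlam
  constructor
  · intro h
    by_contra ha₁
    have e : ((NonArchLinearization.trinomial p lam a₁ a : Polynomial K) : PowerSeries K)
        = PowerSeries.C lam * PowerSeries.X + PowerSeries.C a₁ * PowerSeries.X ^ 2 +
          PowerSeries.C a * PowerSeries.X ^ p := by
      simp [NonArchLinearization.trinomial]
    rw [← e] at h
    have h0 : (NonArchLinearization.trinomial p lam a₁ a).coeff 0 = 0 := by
      rw [Polynomial.coeff_zero_eq_eval_zero]
      simp [NonArchLinearization.trinomial, show p ≠ 0 by omega]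
    have h1 : (NonArchLinearization.trinomial p lam a₁ a).coeff 1 = lam := by
      simp [NonArchLinearization.trinomial, Polynomial.coeff_X_pow, show (1 : ℕ) ≠ p by omega]
    have hP := h.hasPoincareSeries h0
    rw [h1] at hP
    -- The nonzero element `lam - 1` of norm below one shows that the absolute value is nontrivial.
    let _ : NontriviallyNormedField K := NontriviallyNormedField.ofNormNeOne
      ⟨lam - 1, sub_ne_zero.2 (by simpa using hroot 1 one_pos), hlam.ne⟩
    exact NonArchLinearization.not_hasPoincareSeries_trinomial_of_complete (by omega) hroot hlam
      ha₁ a hP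
  · rintro rfl
    simpa using NonArchLinearization.isLinearizable_binomial hroot hlam
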